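/- Setting. Let $\mathcal X,\mathcal Y$ be finite alphabets, let $Q(y|x)$ be the transition matrix of a discrete memoryless channel from $\mathcal X$ to $\mathcal Y$, and let $\star\in\mathcal X$ be a fixed noise symbol. A block code consists of $M\ge 2$ codewords $c(m)=(c_1(m),\dots,c_N(m))\in\mathcal X^N$ and a sequential decoder $(\tau,\phi)$. The message $m$ is uniform on $\{1,\dots,M\}$, and its transmission starts at a time $\nu$ that is independent of $m$ and uniform on $\{1,\dots,A\}$, where the integer $A\ge1$ is the asynchronism level (known to the receiver). Given the message $m$ and $\nu=l$, the receiver observes independent symbols $Y_1,Y_2,\dots$, where $Y_i$ has distribution $Q(\cdot|c_{i-l+1}(m))$ if $l\le i\le l+N-1$ and $Q(\cdot|\star)$ otherwise; write $\mathbb P_{m,l}$ and $\mathbb E_{m,l}$ for this law. Here $\tau$ is a stopping time of the natural filtration of $(Y_i)$, and the declared message $\phi\in\{1,\dots,M\}$ is $\mathcal F_\tau$-measurable. Put $$\mathbb P(\mathcal E)=\frac1{AM}\sum_{m=1}^M\sum_{l=1}^A\mathbb P_{m,l}(\phi\ne m),\qquad \mathbb E(\tau-\nu)^+=\frac1{AM}\sum_{m=1}^M\sum_{l=1}^A\mathbb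 E_{m,l}(\tau-l)^+ ,$$ and call $\ln M/\mathbb E(\tau-\nu)^+$ the rate of the code. An asynchronism exponent $\alpha$ is achievable at rate $R$ if for every $\varepsilon>0$ and all sufficiently large $N$ there is a block code of length $N$ that, at asynchronism level $A=\lceil e^{(\alpha-\varepsilon)N}\rceil$, has rate at least $R-\varepsilon$ and satisfies $\mathbb P(\mathcal E)\le\varepsilon$. For a distribution $P$ on $\mathcal X$ and a conditional distribution $V(y|x)$, let $PV$ be the joint distribution $P(x)V(y|x)$, $(PV)_Y$ its marginal on $\mathcal Y$, and $I(PV)$ its mutual information; $D(\cdot\|\cdot)\in[0,\infty]$ is the Kullback-Leibler divergence. Logarithms are natural, and the infimum over an empty set is $+\infty$. Theorem. Let $\alpha\ge0$, $t_1\ge0$, $t_2>1$, $\delta\in(0,1)$, and let $P$ be a distribution on $\mathcal X$ with $I(PQ)>0$, such that $$\text{(a)}\quad \alpha<\inf\Big\{D((PV)_Y\|(PQ)_Y)\;:\;V,\ D((PV)_Y\|Q(\cdot|\star))<\tfrac{t_1\alpha}{\delta(t_1+t_2-1)}\Big\},$$ $$\text{(b)}\quad \alpha<\min\Big\{D(PV\|PQ)\;:\;V,\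 I(PV)\le\tfrac{t_2\alpha}{\delta(t_1+t_2-1)}\Big\},$$ $$\text{(c)}\quad \frac{t_1}{t_2}<\frac{D((PQ)_Y\|Q(\cdot|\star))}{I(PQ)},$$ where $V$ ranges over all conditional distributions from $\mathcal X$ to $\mathcal Y$. Then the asynchronism exponent $\alpha$ is achievable at rate $I(PQ)/t_2$. -/

import Mathlib

open MeasureTheory ProbabilityTheory InformationTheory Filter
open scoped ENNReal

noncomputable section

namespace AsyncComm

variable {X Y : Type*} [MeasurableSpace X] [MeasurableSpace Y]

/-- The mutual information `I(J)` of a joint distribution `J` on `X × Y`, in nats: the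
Kullback-Leibler divergence from `J` to the product of its two marginals. -/
def mutualInfo (J : Measure (X × Y)) : ℝ≥0∞ :=
  klDiv J (J.fst.prod J.snd)

/-- A block code with `M` codewords of length `N` over the input alphabet `X`, together with a
sequential decoder for output sequences over `Y`.

Time is labelled `0, 1, 2, …`: the output observed first is `y 0`, and the decoder may decide at
time `n` after having seen exactly `y 0, …, y n`.
`Filtration.piLE` is the natural filtration of the output sequence. -/
structure BlockCode (X Y : Type*) [MeasurableSpace Y] (M N : ℕ) where
  /-- The codewords. -/
  codeword : Fin M → Fin N → X
  /-- The time `τ` at which the decision is made. -/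
  decTime : (ℕ → Y) → ℕ
  /-- `τ` is a stopping time of the output sequence. -/
  isStoppingTime : IsStoppingTime (Filtration.piLE (X := fun _ : ℕ => Y))
    (fun y => (decTime y : WithTop ℕ))
  /-- The declared message `φ`. -/
  decision : (ℕ → Y) → Fin M
  /-- `φ` is measurable with respect to the `σ`-algebra of the stopping time. -/
  measurable_decision : Measurable[isStoppingTime.measurableSpace] decision

/-- The channel input at time `i` when the word `c` starts being sent at time `l`: the noise
symbol `star` before time `l` and from time `l + N` on. -/
def channelInput {N : ℕ} (star : X) (c : Fin N → X) (l i : ℕ) : X :=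
  if h : l ≤ i ∧ i < l + N then c ⟨i - l, by omega⟩ else star

/-- The law of the channel output sequence when the word `c` starts being sent at time `l` over
the memoryless channel `Q`: independent outputs, each drawn from `Q` at the current input. -/
def outputLaw (Q : Kernel X Y) {N : ℕ} (star : X) (c : Fin N → X) (l : ℕ) : Measure (ℕ → Y) :=
  Measure.infinitePi (fun i => Q (channelInput star c l i))

namespace BlockCode

variable {M N : ℕ}

/-- The average error probability at asynchronism level `A`: the message is uniform and its
starting time is independent of it and uniform on the first `A` times. -/
def errorProb (C : BlockCode X Y M N) (Q : Kernel X Y) (star : X) (A : ℕ) : ℝ≥0∞ :=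
  (A : ℝ≥0∞)⁻¹ * (M : ℝ≥0∞)⁻¹ * ∑ m : Fin M, ∑ l ∈ Finset.range A,
    outputLaw Q star (C.codeword m) l {y | C.decision y ≠ m}

/-- The expected reaction delay `E (τ - ν)⁺` at asynchronism level `A`
(the subtraction is the truncated one of `ℕ`). -/
def expectedDelay (C : BlockCode X Y M N) (Q : Kernel X Y) (star : X) (A : ℕ) : ℝ≥0∞ :=
  (A : ℝ≥0∞)⁻¹ * (M : ℝ≥0∞)⁻¹ * ∑ m : Fin M, ∑ l ∈ Finset.range A,
    ∫⁻ y, ((C.decTime y - l : ℕ) : ℝ≥0∞) ∂(outputLaw Q star (C.codeword m) l)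

/-- The rate `ln M / E (τ - ν)⁺`, an extended nonnegative number
(`∞` if the delay vanishes and `2 ≤ M`, and `0` if the delay is infinite). -/
def rate (C : BlockCode X Y M N) (Q : Kernel X Y) (star : X) (A : ℕ) : ℝ≥0∞ :=
  ENNReal.ofReal (Real.log M) / C.expectedDelay Q star A

end BlockCode

/-- The asynchronism exponent `α` is achievable at rate `R` over the channel `Q` with noise
symbol `star`: for every `ε > 0` and all sufficiently large lengths `N` there is a block code of
length `N` with at least two messages that, at asynchronism level `e ^ ((α - ε) N)` (rounded up
to an integer, so that it is at least one), has rate at least `R - ε` and error probability at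
most `ε`. -/
def Achievable (Q : Kernel X Y) (star : X) (α R : ℝ) : Prop :=
  ∀ ε : ℝ, 0 < ε → ∀ᶠ N : ℕ in atTop, ∃ M : ℕ, 2 ≤ M ∧ ∃ C : BlockCode X Y M N,
    ENNReal.ofReal (R - ε) ≤ C.rate Q star ⌈Real.exp ((α - ε) * N)⌉₊ ∧
    C.errorProb Q star ⌈Real.exp ((α - ε) * N)⌉₊ ≤ ENNReal.ofReal ε

end AsyncComm

end

set_option linter.unusedSectionVars false

namespace AsyncComm

open Topology

/-! ### Likelihood-ratio and Chebyshev bounds for product measures -/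

section ProductBounds

variable {ι Z : Type*} [Fintype ι] [Fintype Z] [MeasurableSpace Z] [MeasurableSingletonClass Z]

/-! The code uses `⌈exp (r N)⌉` random words and a decoder that looks at windows of two lengths, a
short one `n₀ = ⌈β N⌉` and the full one `N`. A word passes on a window if two likelihood tests
succeed there. In the output test, the window is likelier by `exp (t₁ r N)` under some reference
output law than under noise. In the input test, the word is likelier by `exp (t₂ r N)` under some
backward channel fed with the window than under `P`. The references are the law induced by `P` and
`Q` and all empirical types, so their number is polynomial in `N`.

False alarms. A change of measure (`pi_real_le_card_mul`) bounds the probability of passing each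
test by accident by its threshold, up to the number of references. A wrong word on pure noise must
pass both tests; on the at most `2 N` windows that meet the transmission only the input test is
counted. With `A ≈ exp ((α - ε) N)` the union bound has exponents `r + α - ε - (t₁ + t₂) r` and `r -
t₂ r`. For `α > 0` the choice `r = α / (t₁ + t₂ - 1)` makes the first equal to `-ε`; the second is
negative because `t₂ > 1`. An early stop in favour of the right word is no error and costs no delay.
The averaging is in `exists_code`.

Misses. The delay is at most `n₀ + N p₁ + A p₂`, where `p₁` and `p₂` are the probabilities that the
short and the full window of the true word fail. The short window has linear length, and by
Chebyshev `p₁ = O(1/N)` as soon as `β I > t₂ r` and `β D > t₁ r`, where `D` is the divergence of the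
output law from noise, or a finite truncation of it. By (c) both hold for `β` slightly above `t₂ r /
I`. If the full window fails, its own types fail too, so its conditional type `V` has small output
divergence from noise or small mutual information. By (a) with data processing, or by (b), `V` is
then at divergence more than `α` from `Q`, and the same change of measure gives `p₂ ≤ poly(N) exp
(-(1 - η) α N)` (`likelihood_le_of_fail`). Hence `A p₂ = O(1)`, the delay is `β N + O(1)`, and the
rate is about `r / β`, that is `I / t₂`.

The factor `δ < 1` leaves room in (a) and (b) for replacing `P` by the empirical type of a typical
codeword. -/

lemma pi_real_eq_sum [DecidableEq ι] (μ : ι → Measure Z) [∀ k, IsProbabilityMeasure (μ k)]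
    (S : Set (ι → Z)) [DecidablePred (· ∈ S)] :
    (Measure.pi μ).real S =
      ∑ z ∈ Finset.univ.filter (· ∈ S), ∏ k, (μ k).real {z k} := by
  classical
  have hS : S = ((Finset.univ.filter (· ∈ S) : Finset (ι → Z)) : Set (ι → Z)) := by
    ext; simp
  conv_lhs => rw [hS]
  rw [← sum_measureReal_singleton]
  refine Finset.sum_congr rfl fun z _ => ?_
  simp only [measureReal_def, Measure.pi_singleton, ENNReal.toReal_prod]

/-- If each point of `S` has, for one of finitely many families `ν j` of subprobability weights,
a likelihood under the product of the `μ k` of at most `θ` times its likelihood under `ν j`, then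
`S` has probability at most `θ` times the number of families. -/
lemma pi_real_le_card_mul {J : Type*} [Fintype J] (μ : ι → Measure Z)
    [∀ k, IsProbabilityMeasure (μ k)] (S : Set (ι → Z)) {θ : ℝ} (hθ : 0 ≤ θ)
    (ν : J → ι → Z → ℝ) (hν : ∀ j k z, 0 ≤ ν j k z) (hν1 : ∀ j k, ∑ z, ν j k z ≤ 1)
    (h : ∀ z ∈ S, ∃ j, ∏ k, (μ k).real {z k} ≤ θ * ∏ k, ν j k (z k)) :
    (Measure.pi μ).real S ≤ Fintype.card J * θ := by
  classical
  rw [pi_real_eq_sum]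
  have hnn : ∀ j (z : ι → Z), 0 ≤ θ * ∏ k, ν j k (z k) := fun j z =>
    mul_nonneg hθ (Finset.prod_nonneg fun k _ => hν j k _)
  calc ∑ z ∈ Finset.univ.filter (· ∈ S), ∏ k, (μ k).real {z k}
      ≤ ∑ z ∈ Finset.univ.filter (· ∈ S), ∑ j, θ * ∏ k, ν j k (z k) := by
        refine Finset.sum_le_sum fun z hz => ?_
        obtain ⟨j, hj⟩ := h z (by simpa using hz)
        exact hj.trans (Finset.single_le_sum (f := fun j => θ * ∏ k, ν j k (z k))
          (fun j _ => hnn j z) (Finset.mem_univ j))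
    _ ≤ ∑ z : ι → Z, ∑ j, θ * ∏ k, ν j k (z k) :=
        Finset.sum_le_sum_of_subset_of_nonneg (Finset.filter_subset _ _)
          fun z _ _ => Finset.sum_nonneg fun j _ => hnn j z
    _ = ∑ j, θ * ∏ k, ∑ z, ν j k z := by
        rw [Finset.sum_comm]
        refine Finset.sum_congr rfl fun j _ => ?_
        rw [← Finset.mul_sum, Finset.prod_univ_sum, Fintype.piFinset_univ]
    _ ≤ ∑ _j : J, θ := by
        refine Finset.sum_le_sum fun j _ => mul_le_of_le_one_right hθ ?_
        exact Finset.prod_le_one (fun k _ => Finset.sum_nonneg fun z _ => hν j k z)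
          fun k _ => hν1 j k
    _ = Fintype.card J * θ := by simp

/-- Chebyshev's inequality for a sum of functions of independent coordinates. -/
lemma pi_real_sum_le_sub (μ : ι → Measure Z) [∀ k, IsProbabilityMeasure (μ k)]
    (g : ι → Z → ℝ) {K s : ℝ} (hK : ∀ k z, |g k z| ≤ K) (hs : 0 < s) :
    (Measure.pi μ).real {z | ∑ k, g k (z k) ≤ ∑ k, ∫ z, g k z ∂(μ k) - s}
      ≤ Fintype.card ι * K ^ 2 / s ^ 2 := by
  have hLp : ∀ k, MemLp (g k) 2 (μ k) := fun k => MemLp.of_discrete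
  have hvar := variance_sum_pi (μ := μ) (X := g) hLp
  have hLpS : MemLp (∑ k, fun z : ι → Z => g k (z k)) 2 (Measure.pi μ) := MemLp.of_discrete
  have hmean : (Measure.pi μ)[∑ k, fun z : ι → Z => g k (z k)] = ∑ k, ∫ z, g k z ∂(μ k) := by
    simp only [Finset.sum_apply]
    rw [integral_finsetSum _ fun k _ => Integrable.of_finite]
    refine Finset.sum_congr rfl fun k _ => ?_
    exact integral_comp_eval (μ := μ) (i := k) (f := g k) (Measurable.of_discrete.aestronglyMeasurable)
  have hv : variance (∑ k, fun z : ι → Z => g k (z k)) (Measure.pi μ)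
      ≤ Fintype.card ι * K ^ 2 := by
    rw [hvar, ← nsmul_eq_mul, ← Finset.card_univ, ← Finset.sum_const]
    refine Finset.sum_le_sum fun k _ => ?_
    refine (variance_le_expectation_sq (hLp k).1).trans ?_
    have : ∫ z, (g k ^ 2) z ∂(μ k) ≤ ∫ _z, K ^ 2 ∂(μ k) := by
      refine integral_mono Integrable.of_finite Integrable.of_finite fun z => ?_
      simpa using sq_le_sq' (abs_le.1 (hK k z)).1 (abs_le.1 (hK k z)).2
    simpa using this
  have hch := meas_ge_le_variance_div_sq hLpS hs
  rw [hmean] at hch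
  have hsub : {z : ι → Z | ∑ k, g k (z k) ≤ ∑ k, ∫ z, g k z ∂(μ k) - s} ⊆
      {z | s ≤ |(∑ k, fun z : ι → Z => g k (z k)) z - ∑ k, ∫ z, g k z ∂(μ k)|} := by
    intro z hz
    simp only [Set.mem_ofPred_eq, Finset.sum_apply] at hz ⊢
    rw [abs_sub_comm]
    exact le_trans (by linarith) (le_abs_self _)
  have h1 := (measure_mono hsub).trans hch
  rw [measureReal_def]
  refine (ENNReal.toReal_le_of_le_ofReal (div_nonneg (variance_nonneg _ _) (sq_nonneg s))
    h1).trans ?_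
  gcongr

end ProductBounds

/-! ### Windows of the output sequence and their laws -/

section Window

variable {X Y : Type*} [MeasurableSpace X] [MeasurableSpace Y]

/-- The window of length `N` of the output sequence that starts at time `s`. -/
def window (N s : ℕ) (y : ℕ → Y) : Fin N → Y := fun k => y (s + k)

lemma measurable_window (N s : ℕ) : Measurable (window (Y := Y) N s) :=
  measurable_pi_lambda _ fun _ => measurable_pi_apply _

lemma map_window_outputLaw (Q : Kernel X Y) [IsMarkovKernel Q] {N : ℕ} (star : X)
    (c : Fin N → X) (l s : ℕ) :
    (outputLaw Q star c l).map (window N s) =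
      Measure.pi fun k : Fin N => Q (channelInput star c l (s + k)) := by
  classical
  symm
  refine Measure.pi_eq fun S hS => ?_
  rw [Measure.map_apply (measurable_window N s) (MeasurableSet.univ_pi hS)]
  let e : Fin N ↪ ℕ := ⟨fun k => s + k, fun a b h => by ext; simpa using h⟩
  -- The box on the window becomes a cylinder on the whole sequence: each side is moved along `k ↦ s
  -- + k`, and all other times are unconstrained.
  let t : ℕ → Set Y := fun n => if h : ∃ k, e k = n then S h.choose else Set.univ
  have ht : ∀ k, t (e k) = S k := fun k => by
    have h : ∃ k', e k' = e k := ⟨k, rfl⟩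
    simp only [t, dif_pos h]
    rw [e.injective h.choose_spec]
  have hpre : window N s ⁻¹' Set.univ.pi S = Set.pi (Finset.univ.map e : Finset ℕ) t := by
    ext y
    simp only [Set.mem_preimage, Set.mem_pi, Finset.coe_map, Set.mem_image,
      Finset.coe_univ, Set.mem_univ, true_and, true_imp_iff, forall_exists_index, forall_apply_eq_imp_iff, ht]
    rfl
  rw [hpre, outputLaw, Measure.infinitePi_pi, Finset.prod_map]
  · simp only [ht]; rfl
  · intro n _
    simp only [t]
    split_ifs
    · exact hS _
    · exact MeasurableSet.univ

instance (Q : Kernel X Y) [IsMarkovKernel Q] {N : ℕ} (star : X)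
    (c : Fin N → X) (l : ℕ) : IsProbabilityMeasure (outputLaw Q star c l) := by
  unfold outputLaw; infer_instance

lemma outputLaw_window [Finite Y] [MeasurableSingletonClass Y] (Q : Kernel X Y) [IsMarkovKernel Q]
    {N : ℕ} (star : X) (c : Fin N → X) (l s : ℕ) (S : Set (Fin N → Y)) :
    outputLaw Q star c l {y | window N s y ∈ S} =
      (Measure.pi fun k : Fin N => Q (channelInput star c l (s + k))) S := by
  rw [← map_window_outputLaw, Measure.map_apply (measurable_window N s) S.toFinite.measurableSet]
  rfl

end Window

section Input

variable {X : Type*}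

lemma channelInput_add {N : ℕ} (star : X) (c : Fin N → X) (l : ℕ) (k : Fin N) :
    channelInput star c l (l + k) = c k := by
  simp [channelInput]

lemma channelInput_of_lt_or_le {N : ℕ} (star : X) (c : Fin N → X) {l i : ℕ}
    (h : i < l ∨ l + N ≤ i) : channelInput star c l i = star := by
  rw [channelInput, dif_neg (by omega)]

end Input

/-! ### Selection of a codebook by the first moment method -/

section Codebook

/-- First moment method over codebooks with independent codewords: if for each word `c` the
mean of `f c` over a random word is at most `B`, then some codebook avoiding the null set has
all its sums over pairs of distinct codewords bounded by the corresponding mean. -/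
lemma exists_codebook {W : Type*} [Finite W] [MeasurableSpace W] [MeasurableSingletonClass W]
    (ρ : Measure W) [IsProbabilityMeasure ρ] (f : W → W → ℝ≥0∞) (B : ℝ≥0∞)
    (hB : ∀ c, ∫⁻ c', f c c' ∂ρ ≤ B) (G : Set W) (hG : ρ Gᶜ = 0) (M : ℕ) :
    ∃ C : Fin M → W, (∀ m, C m ∈ G) ∧
      ∑ m, ∑ m' ∈ Finset.univ.erase m, f (C m) (C m') ≤ M * (M * B) := by
  classical
  let μ := Measure.pi fun _ : Fin M => ρ
  have hnull : μ {C | ∃ m, C m ∉ G} = 0 := by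
    rw [show {C : Fin M → W | ∃ m, C m ∉ G} = ⋃ m, Function.eval m ⁻¹' Gᶜ by ext; simp]
    refine measure_iUnion_null fun m => ?_
    rw [(measurePreserving_eval (fun _ : Fin M => ρ) m).measure_preimage
      (Set.toFinite _).measurableSet.nullMeasurableSet, hG]
  obtain ⟨C, hC, hle⟩ := exists_notMem_null_le_lintegral (μ := μ)
    (f := fun C => ∑ m, ∑ m' ∈ Finset.univ.erase m, f (C m) (C m'))
    (Measurable.of_discrete.aemeasurable) hnull
  refine ⟨C, fun m => by_contra fun h => hC ⟨m, h⟩, hle.trans ?_⟩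
  rw [lintegral_finsetSum _ fun _ _ => Measurable.of_discrete]
  have key : ∀ m, ∀ m' ∈ Finset.univ.erase m, ∫⁻ C, f (C m) (C m') ∂μ ≤ B := by
    intro m m' hm'
    have hne : m ≠ m' := fun h => by simp [h] at hm'
    have : ∫⁻ C, f (C m) (C m') ∂μ ≤ ∫⁻ _C, B ∂μ := by
      -- Only the tested codeword is integrated out, with all others frozen; this is where
      -- independence of distinct codewords enters.
      refine lintegral_le_of_lmarginal_le {m'} Measurable.of_discrete measurable_const ?_
      intro C
      rw [lmarginal_singleton, lmarginal_singleton]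
      simp only [Function.update_self, Function.update_of_ne hne, lintegral_const, measure_univ,
        mul_one]
      exact hB _
    simpa [μ] using this
  calc ∑ m, ∫⁻ C, ∑ m' ∈ Finset.univ.erase m, f (C m) (C m') ∂μ
      ≤ ∑ m : Fin M, (M : ℝ≥0∞) * B := by
        refine Finset.sum_le_sum fun m _ => ?_
        rw [lintegral_finsetSum _ fun _ _ => Measurable.of_discrete]
        refine (Finset.sum_le_sum (key m)).trans ?_
        rw [Finset.sum_const, nsmul_eq_mul]
        gcongr
        exact (Finset.card_erase_le).trans (by simp)
    _ = M * (M * B) := by simp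

end Codebook

/-! ### Divergence on finite alphabets -/

section FiniteDivergence

variable {Z : Type*} [Fintype Z] [MeasurableSpace Z] [MeasurableSingletonClass Z]

/-- Gibbs' inequality from `log x ≤ x - 1` applied termwise. Absolute continuity is indispensable,
since the real logarithm gives the terms with `q z = 0` the value zero. -/
lemma sum_mul_log_div_nonneg {p q : Z → ℝ} (hp : ∀ z, 0 ≤ p z) (hq : ∀ z, 0 ≤ q z)
    (hpq : ∑ z, q z ≤ ∑ z, p z) (hac : ∀ z, q z = 0 → p z = 0) :
    0 ≤ ∑ z, p z * Real.log (p z / q z) := by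
  have h : ∀ z, p z - q z ≤ p z * Real.log (p z / q z) := by
    intro z
    rcases (hp z).eq_or_lt with h0 | h0
    · simp [← h0, hq z]
    have hqz : 0 < q z := (hq z).lt_of_ne fun h => h0.ne' (hac z h.symm)
    have := Real.log_le_sub_one_of_pos (div_pos hqz h0)
    rw [← inv_div (p z) (q z), Real.log_inv, inv_div] at this
    have h2 := mul_le_mul_of_nonneg_left this h0.le
    rw [mul_sub, mul_one, mul_div_cancel₀ _ h0.ne'] at h2
    linarith
  calc (0 : ℝ) ≤ ∑ z, (p z - q z) := by rw [Finset.sum_sub_distrib]; linarith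
    _ ≤ _ := Finset.sum_le_sum fun z _ => h z

lemma absolutelyContinuous_of_real_singleton {μ ν : Measure Z} [IsFiniteMeasure μ]
    [IsFiniteMeasure ν] (hac : ∀ z, ν.real {z} = 0 → μ.real {z} = 0) : μ ≪ ν := by
  intro S hS
  rw [← Set.biUnion_of_singleton S, measure_biUnion_null_iff S.to_countable]
  intro z hz
  have h0 : ν {z} = 0 := measure_mono_null (Set.singleton_subset_iff.2 hz) hS
  have := hac z (by simp [measureReal_def, h0])
  simpa [measureReal_def, ENNReal.toReal_eq_zero_iff] using this

/-- On an atom the Radon-Nikodym derivative is the ratio of the masses. Absolute continuity keeps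
the divergence finite, which the real sum could not express otherwise. -/
lemma klDiv_eq_ofReal_sum {μ ν : Measure Z} [IsProbabilityMeasure μ] [IsProbabilityMeasure ν]
    (hac : ∀ z, ν.real {z} = 0 → μ.real {z} = 0) :
    klDiv μ ν = ENNReal.ofReal (∑ z, μ.real {z} * Real.log (μ.real {z} / ν.real {z})) := by
  have h := absolutelyContinuous_of_real_singleton hac
  rw [← ENNReal.ofReal_toReal (klDiv_ne_top h Integrable.of_finite),
    toReal_klDiv_of_measure_eq h (by simp), integral_fintype Integrable.of_finite]
  congr 1
  refine Finset.sum_congr rfl fun z _ => ?_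
  rcases eq_or_ne (μ.real {z}) 0 with h0 | h0
  · simp [h0]
  have hν : ν.real {z} ≠ 0 := fun h => h0 (hac z h)
  have hr : (μ.rnDeriv ν z).toReal * ν.real {z} = μ.real {z} := by
    have := Measure.setLIntegral_rnDeriv h {z}
    rw [lintegral_singleton] at this
    rw [measureReal_def, measureReal_def, ← ENNReal.toReal_mul, this]
  rw [smul_eq_mul, llr, ← hr, mul_div_cancel_right₀ _ hν]

/-- The measure on a finite type with the given weights. -/
noncomputable def measureOfWeights (p : Z → ℝ) : Measure Z :=
  ∑ z, ENNReal.ofReal (p z) • Measure.dirac z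

lemma measureOfWeights_singleton (p : Z → ℝ) (z : Z) :
    measureOfWeights p {z} = ENNReal.ofReal (p z) := by
  classical
  rw [measureOfWeights, Measure.finsetSum_apply, Finset.sum_eq_single z]
  · simp
  · intro b _ hb
    simp [hb]
  · simp

lemma measureOfWeights_real_singleton {p : Z → ℝ} (hp : ∀ z, 0 ≤ p z) (z : Z) :
    (measureOfWeights p).real {z} = p z := by
  rw [measureReal_def, measureOfWeights_singleton, ENNReal.toReal_ofReal (hp z)]

lemma isProbabilityMeasure_measureOfWeights {p : Z → ℝ} (hp : ∀ z, 0 ≤ p z)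
    (h1 : ∑ z, p z = 1) : IsProbabilityMeasure (measureOfWeights p) := by
  constructor
  rw [measureOfWeights, Measure.finsetSum_apply]
  simp only [Measure.smul_apply, measure_univ, smul_eq_mul, mul_one]
  rw [← ENNReal.ofReal_sum_of_nonneg fun z _ => hp z, h1, ENNReal.ofReal_one]

lemma sum_real_singleton (μ : Measure Z) [IsProbabilityMeasure μ] : ∑ z, μ.real {z} = 1 := by
  rw [sum_measureReal_singleton]
  simp

end FiniteDivergence

/-! ### Joint laws, conditional divergence and mutual information -/

section JointLaw

variable {X Y : Type*} [Fintype X] [MeasurableSpace X] [MeasurableSingletonClass X]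
  [Fintype Y] [MeasurableSpace Y] [MeasurableSingletonClass Y]

lemma compProd_real_singleton (P : Measure X) [IsProbabilityMeasure P] (V : Kernel X Y)
    [IsMarkovKernel V] (x : X) (y : Y) :
    (P ⊗ₘ V).real {(x, y)} = P.real {x} * (V x).real {y} := by
  rw [measureReal_def, ← Set.singleton_prod_singleton,
    Measure.compProd_apply_prod (measurableSet_singleton x) (measurableSet_singleton y),
    lintegral_singleton, ENNReal.toReal_mul, mul_comm]
  rfl

lemma compProd_snd_real_singleton (P : Measure X) [IsProbabilityMeasure P] (V : Kernel X Y)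
    [IsMarkovKernel V] (y : Y) :
    (P ⊗ₘ V).snd.real {y} = ∑ x, P.real {x} * (V x).real {y} := by
  simp only [← compProd_real_singleton]
  rw [measureReal_def, Measure.snd_apply (measurableSet_singleton y), ← measureReal_def,
    show (Prod.snd ⁻¹' {y} : Set (X × Y)) =
      ((Finset.univ.map ⟨fun x => (x, y), fun a b h => by simpa using h⟩ : Finset (X × Y)) :
        Set (X × Y)) by
      ext ⟨a, b⟩
      simp only [Set.mem_preimage, Set.mem_singleton_iff, Finset.coe_map, Set.mem_image,
        Finset.coe_univ, Set.mem_univ, true_and]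
      exact ⟨fun h => ⟨a, by rw [← h]; rfl⟩, fun ⟨_, h⟩ => (Prod.ext_iff.1 h).2.symm⟩,
    ← sum_measureReal_singleton, Finset.sum_map]
  rfl

lemma prod_real_singleton (μ : Measure X) (ν : Measure Y) [IsProbabilityMeasure μ]
    [IsProbabilityMeasure ν] (x : X) (y : Y) :
    (μ.prod ν).real {(x, y)} = μ.real {x} * ν.real {y} := by
  rw [← Set.singleton_prod_singleton, measureReal_prod_prod]

/-- The factor `P.real {x}` cancels in the ratio. Rows of zero mass carry no condition, so a
conditional type may be completed arbitrarily there. -/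
lemma klDiv_compProd_eq (P : Measure X) [IsProbabilityMeasure P] (V Q : Kernel X Y)
    [IsMarkovKernel V] [IsMarkovKernel Q]
    (hac : ∀ x y, P.real {x} ≠ 0 → (Q x).real {y} = 0 → (V x).real {y} = 0) :
    klDiv (P ⊗ₘ V) (P ⊗ₘ Q) = ENNReal.ofReal (∑ x, P.real {x} *
      ∑ y, (V x).real {y} * Real.log ((V x).real {y} / (Q x).real {y})) := by
  rw [klDiv_eq_ofReal_sum]
  · congr 1
    rw [Fintype.sum_prod_type]
    refine Finset.sum_congr rfl fun x _ => ?_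
    rw [Finset.mul_sum]
    refine Finset.sum_congr rfl fun y _ => ?_
    simp only [compProd_real_singleton]
    rcases eq_or_ne (P.real {x}) 0 with h | h
    · simp [h]
    · rw [mul_div_mul_left _ _ h, mul_assoc]
  · rintro ⟨x, y⟩ h
    simp only [compProd_real_singleton, mul_eq_zero] at h ⊢
    by_cases hx : P.real {x} = 0
    · exact Or.inl hx
    · exact Or.inr (hac x y hx (h.resolve_left hx))

lemma snd_real_ne_zero (P : Measure X) [IsProbabilityMeasure P] (V : Kernel X Y)
    [IsMarkovKernel V] {x : X} {y : Y} (hx : P.real {x} ≠ 0) (hy : (V x).real {y} ≠ 0) :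
    0 < (P ⊗ₘ V).snd.real {y} := by
  rw [compProd_snd_real_singleton]
  refine lt_of_lt_of_le (?_ : 0 < P.real {x} * (V x).real {y}) ?_
  · exact mul_pos (measureReal_nonneg.lt_of_ne' hx) (measureReal_nonneg.lt_of_ne' hy)
  · exact Finset.single_le_sum (f := fun x => P.real {x} * (V x).real {y})
      (fun x _ => mul_nonneg measureReal_nonneg measureReal_nonneg) (Finset.mem_univ x)

/-- No domination has to be assumed: a joint law is always absolutely continuous with respect to the
product of its marginals. -/
lemma mutualInfo_compProd_eq (P : Measure X) [IsProbabilityMeasure P] (V : Kernel X Y)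
    [IsMarkovKernel V] :
    mutualInfo (P ⊗ₘ V) = ENNReal.ofReal (∑ x, P.real {x} *
      ∑ y, (V x).real {y} * Real.log ((V x).real {y} / (P ⊗ₘ V).snd.real {y})) := by
  rw [mutualInfo, Measure.fst_compProd, klDiv_eq_ofReal_sum]
  · congr 1
    rw [Fintype.sum_prod_type]
    refine Finset.sum_congr rfl fun x _ => ?_
    rw [Finset.mul_sum]
    refine Finset.sum_congr rfl fun y _ => ?_
    simp only [compProd_real_singleton, prod_real_singleton]
    rcases eq_or_ne (P.real {x}) 0 with h | h
    · simp [h]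
    · rw [mul_div_mul_left _ _ h, mul_assoc]
  · rintro ⟨x, y⟩ h
    simp only [compProd_real_singleton, prod_real_singleton, mul_eq_zero] at h ⊢
    by_contra! h'
    rcases h with h | h
    · exact h'.1 h
    · exact (snd_real_ne_zero P V h'.1 h'.2).ne' h

/-- The mutual information is at most the mean divergence from any fixed output distribution. -/
lemma mutualInfo_compProd_le (P : Measure X) [IsProbabilityMeasure P] (V : Kernel X Y)
    [IsMarkovKernel V] {q : Y → ℝ} (hq : ∀ y, 0 ≤ q y) (hq1 : ∑ y, q y ≤ 1)
    (hac : ∀ x y, P.real {x} ≠ 0 → q y = 0 → (V x).real {y} = 0) :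
    mutualInfo (P ⊗ₘ V) ≤ ENNReal.ofReal (∑ x, P.real {x} *
      ∑ y, (V x).real {y} * Real.log ((V x).real {y} / q y)) := by
  rw [mutualInfo_compProd_eq]
  refine ENNReal.ofReal_le_ofReal ?_
  set p : Y → ℝ := fun y => (P ⊗ₘ V).snd.real {y}
  have hpac : ∀ y, q y = 0 → p y = 0 := by
    intro y hy
    simp only [p, compProd_snd_real_singleton]
    refine Finset.sum_eq_zero fun x _ => ?_
    by_cases hx : P.real {x} = 0
    · simp [hx]
    · simp [hac x y hx hy]
  have hg := sum_mul_log_div_nonneg (p := p) (q := q) (fun y => measureReal_nonneg) hq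
    (by rw [sum_real_singleton]; exact hq1) hpac
  -- The two sides of the inequality differ exactly by the divergence of the true output marginal
  -- `p` from `q`.
  have hsplit : ∑ x, P.real {x} * ∑ y, (V x).real {y} * Real.log ((V x).real {y} / q y)
      = ∑ x, P.real {x} * ∑ y, (V x).real {y} * Real.log ((V x).real {y} / p y)
        + ∑ y, p y * Real.log (p y / q y) := by
    have : ∑ y, p y * Real.log (p y / q y)
        = ∑ x, P.real {x} * ∑ y, (V x).real {y} * Real.log (p y / q y) := by
      simp only [Finset.mul_sum]
      rw [Finset.sum_comm]
      refine Finset.sum_congr rfl fun y _ => ?_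
      simp only [← mul_assoc]
      rw [← Finset.sum_mul, ← compProd_snd_real_singleton]
    rw [this, ← Finset.sum_add_distrib]
    refine Finset.sum_congr rfl fun x _ => ?_
    rw [← mul_add, ← Finset.sum_add_distrib]
    by_cases hx : P.real {x} = 0
    · simp [hx]
    congr 1
    refine Finset.sum_congr rfl fun y _ => ?_
    by_cases hy : (V x).real {y} = 0
    · simp [hy]
    have hp0 : p y ≠ 0 := (snd_real_ne_zero P V hx hy).ne'
    have hq0 : q y ≠ 0 := fun h => hy (hac x y hx h)
    rw [← mul_add, ← Real.log_mul (by positivity) (by positivity)]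
    congr 2
    field_simp
  linarith

end JointLaw

/-! ### Replacing the input law by a nearby empirical type -/

section Perturbation

variable {X Y : Type*} [Fintype X] [MeasurableSpace X] [MeasurableSingletonClass X]
  [Fintype Y] [MeasurableSpace Y] [MeasurableSingletonClass Y]
  (P : Measure X) [IsProbabilityMeasure P] (V : Kernel X Y) [IsMarkovKernel V]
  {P' : X → ℝ} {η : ℝ}

/-- The output law `q` of the perturbed input is used as the reference in `mutualInfo_compProd_le`.
Each row divergence from `q` is nonnegative, so passing from the weights `P` to `P'` costs only the
factor `(1 - η)⁻¹`. -/
lemma mutualInfo_le_of_close (hη : η < 1) (hP'0 : ∀ x, 0 ≤ P' x) (hP'1 : ∑ x, P' x = 1)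
    (hlow : ∀ x, (1 - η) * P.real {x} ≤ P' x) {q : Y → ℝ}
    (hq : ∀ y, q y = ∑ x, P' x * (V x).real {y}) :
    mutualInfo (P ⊗ₘ V) ≤ ENNReal.ofReal ((1 - η)⁻¹ * ∑ x, P' x *
      ∑ y, (V x).real {y} * Real.log ((V x).real {y} / q y)) := by
  have hη' : 0 < 1 - η := by linarith
  have hq0 : ∀ y, 0 ≤ q y := fun y => by
    rw [hq]; exact Finset.sum_nonneg fun x _ => mul_nonneg (hP'0 x) measureReal_nonneg
  have hq1 : ∑ y, q y = 1 := by
    simp only [hq]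
    rw [Finset.sum_comm]
    simp only [← Finset.mul_sum, sum_real_singleton, mul_one, hP'1]
  have hac' : ∀ x y, P' x ≠ 0 → q y = 0 → (V x).real {y} = 0 := by
    intro x y hx hy
    rw [hq, Finset.sum_eq_zero_iff_of_nonneg
      fun x _ => mul_nonneg (hP'0 x) measureReal_nonneg] at hy
    exact (mul_eq_zero.1 (hy x (Finset.mem_univ x))).resolve_left hx
  have hPP' : ∀ x, P.real {x} ≠ 0 → P' x ≠ 0 := by
    intro x hx h0
    have := hlow x
    rw [h0] at this
    have h1 : 0 < P.real {x} := measureReal_nonneg.lt_of_ne' hx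
    nlinarith [mul_pos hη' h1]
  refine (mutualInfo_compProd_le P V hq0 hq1.le fun x y hx => hac' x y (hPP' x hx)).trans ?_
  refine ENNReal.ofReal_le_ofReal ?_
  rw [Finset.mul_sum]
  refine Finset.sum_le_sum fun x _ => ?_
  rw [← mul_assoc]
  by_cases hx : P' x = 0
  · have : P.real {x} = 0 := by by_contra h; exact hPP' x h hx
    simp [hx, this]
  refine mul_le_mul_of_nonneg_right ?_ ?_
  · rw [inv_mul_eq_div, le_div_iff₀ hη', mul_comm]; exact hlow x
  · exact sum_mul_log_div_nonneg (fun y => measureReal_nonneg) hq0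
      (by rw [hq1, sum_real_singleton]) fun y => hac' x y hx

/-- The output laws satisfy `p ≤ q / (1 - η)` pointwise, so replacing `p` by `q` inside the
logarithm costs `-log (1 - η)`. Replacing it as the weight costs `|p - q|` times a logarithm, which
stays bounded because `|q log q| ≤ 1`. The error vanishes with `η`, for fixed `μ`. -/
lemma klDiv_snd_le_of_close (hη0 : 0 ≤ η) (hη : η < 1) (hP'1 : ∑ x, P' x = 1)
    (hlow : ∀ x, (1 - η) * P.real {x} ≤ P' x) (hup : ∀ x, P' x ≤ (1 + η) * P.real {x})
    (μ : Measure Y) [IsProbabilityMeasure μ] {q : Y → ℝ}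
    (hq : ∀ y, q y = ∑ x, P' x * (V x).real {y}) (hqμ : ∀ y, μ.real {y} = 0 → q y = 0) :
    klDiv (P ⊗ₘ V).snd μ ≤ ENNReal.ofReal (∑ y, q y * Real.log (q y / μ.real {y})
      + (-Real.log (1 - η) + η / (1 - η) *
        (Fintype.card Y * (1 + ∑ y, |Real.log (μ.real {y})|)))) := by
  have hη' : 0 < 1 - η := by linarith
  set K := ∑ y, |Real.log (μ.real {y})|
  set p : Y → ℝ := fun y => (P ⊗ₘ V).snd.real {y}
  have hp0 : ∀ y, 0 ≤ p y := fun y => measureReal_nonneg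
  have hP'0 : ∀ x, 0 ≤ P' x := fun x =>
    (mul_nonneg hη'.le measureReal_nonneg).trans (hlow x)
  have hq0 : ∀ y, 0 ≤ q y := fun y => by
    rw [hq]; exact Finset.sum_nonneg fun x _ => mul_nonneg (hP'0 x) measureReal_nonneg
  have hq1 : ∑ y, q y = 1 := by
    simp only [hq]
    rw [Finset.sum_comm]
    simp only [← Finset.mul_sum, sum_real_singleton, mul_one, hP'1]
  have hpq : ∀ y, (1 - η) * p y ≤ q y := by
    intro y
    simp only [p, compProd_snd_real_singleton, hq, Finset.mul_sum, ← mul_assoc]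
    exact Finset.sum_le_sum fun x _ => mul_le_mul_of_nonneg_right (hlow x) measureReal_nonneg
  have hqp : ∀ y, q y ≤ (1 + η) * p y := by
    intro y
    simp only [p, compProd_snd_real_singleton, hq, Finset.mul_sum, ← mul_assoc]
    exact Finset.sum_le_sum fun x _ => mul_le_mul_of_nonneg_right (hup x) measureReal_nonneg
  have hpac : ∀ y, q y = 0 → p y = 0 := fun y h => by
    have := hpq y
    rw [h] at this
    nlinarith [hp0 y]
  rw [klDiv_eq_ofReal_sum fun y hy => hpac y (hqμ y hy)]
  refine ENNReal.ofReal_le_ofReal ?_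
  have hterm : ∀ y, p y * Real.log (p y / μ.real {y}) ≤
      p y * -Real.log (1 - η) + (q y * Real.log (q y / μ.real {y}) + η / (1 - η) * (1 + K)) := by
    intro y
    have hK : |Real.log (μ.real {y})| ≤ K :=
      Finset.single_le_sum (f := fun y => |Real.log (μ.real {y})|)
        (fun _ _ => abs_nonneg _) (Finset.mem_univ y)
    have hK0 : 0 ≤ K := (abs_nonneg _).trans hK
    rcases eq_or_ne (q y) 0 with h0 | h0
    · have : p y = 0 := hpac y h0
      simp only [this, h0, zero_mul, zero_add]
      positivity
    have hqpos : 0 < q y := (hq0 y).lt_of_ne' h0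
    have hppos : 0 < p y := by nlinarith [hqp y]
    have hμpos : 0 < μ.real {y} := measureReal_nonneg.lt_of_ne' fun h => h0 (hqμ y h)
    have hqle1 : q y ≤ 1 := hq1 ▸ Finset.single_le_sum (fun y _ => hq0 y) (Finset.mem_univ y)
    have hlogp : Real.log (p y) ≤ -Real.log (1 - η) + Real.log (q y) := by
      rw [← Real.log_inv, ← Real.log_mul (inv_pos.2 hη').ne' h0]
      refine Real.log_le_log hppos ?_
      rw [inv_mul_eq_div, le_div_iff₀ hη', mul_comm]; exact hpq y
    have habs : |(p y - q y) * (Real.log (q y) - Real.log (μ.real {y}))|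
        ≤ η / (1 - η) * (1 + K) := by
      rw [abs_mul]
      have h1 : |p y - q y| ≤ η / (1 - η) * q y := by
        have h2 : p y ≤ q y / (1 - η) := by
          rw [le_div_iff₀ hη', mul_comm]; exact hpq y
        have h3 : |p y - q y| ≤ η * p y := abs_le.2 ⟨by linarith [hqp y], by linarith [hpq y]⟩
        calc |p y - q y| ≤ η * p y := h3
          _ ≤ η * (q y / (1 - η)) := mul_le_mul_of_nonneg_left h2 hη0
          _ = _ := by ring
      have h4 : |Real.log (q y) - Real.log (μ.real {y})| ≤ |Real.log (q y)| + K :=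
        (abs_sub _ _).trans (by linarith)
      have h5 : q y * |Real.log (q y)| ≤ 1 := by
        have := (Real.abs_log_mul_self_lt (q y) hqpos hqle1).le
        rwa [abs_mul, abs_of_pos hqpos, mul_comm] at this
      have h6 : 0 ≤ η / (1 - η) := by positivity
      calc _ ≤ η / (1 - η) * q y * (|Real.log (q y)| + K) :=
            mul_le_mul h1 h4 (abs_nonneg _) (mul_nonneg h6 (hq0 y))
        _ = η / (1 - η) * (q y * |Real.log (q y)| + q y * K) := by ring
        _ ≤ η / (1 - η) * (1 + K) := by
          refine mul_le_mul_of_nonneg_left (add_le_add h5 ?_) h6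
          nlinarith
    rw [Real.log_div hppos.ne' hμpos.ne', Real.log_div h0 hμpos.ne']
    have := (abs_le.1 habs).2
    nlinarith [mul_le_mul_of_nonneg_left hlogp hppos.le]
  calc ∑ y, p y * Real.log (p y / μ.real {y})
      ≤ ∑ y, (p y * -Real.log (1 - η) +
        (q y * Real.log (q y / μ.real {y}) + η / (1 - η) * (1 + K))) :=
        Finset.sum_le_sum fun y _ => hterm y
    _ = _ := by
        rw [Finset.sum_add_distrib, Finset.sum_add_distrib, ← Finset.sum_mul,
          sum_real_singleton, Finset.sum_const, Finset.card_univ, nsmul_eq_mul]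
        ring

/-- Row divergences are nonnegative, so the lower bound `(1 - η) P ≤ P'` on the weights is inherited
by the mean. This carries the hypotheses on `P` over to the actual type of a codeword. -/
lemma le_sum_of_lt_klDiv_of_close (Q : Kernel X Y) [IsMarkovKernel Q] (hη : η < 1)
    (hlow : ∀ x, (1 - η) * P.real {x} ≤ P' x)
    (hac : ∀ x y, P' x ≠ 0 → (Q x).real {y} = 0 → (V x).real {y} = 0) {α : ℝ}
    (h : ENNReal.ofReal α < klDiv (P ⊗ₘ V) (P ⊗ₘ Q)) :
    (1 - η) * α ≤ ∑ x, P' x *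
      ∑ y, (V x).real {y} * Real.log ((V x).real {y} / (Q x).real {y}) := by
  have hη' : 0 < 1 - η := by linarith
  have hPP' : ∀ x, P.real {x} ≠ 0 → P' x ≠ 0 := by
    intro x hx h0
    have := hlow x
    rw [h0] at this
    have h1 : 0 < P.real {x} := measureReal_nonneg.lt_of_ne' hx
    nlinarith [mul_pos hη' h1]
  rw [klDiv_compProd_eq P V Q fun x y hx => hac x y (hPP' x hx)] at h
  have h1 := (ENNReal.ofReal_lt_ofReal_iff'.1 h).1
  refine (mul_le_mul_of_nonneg_left h1.le hη'.le).trans ?_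
  rw [Finset.mul_sum]
  refine Finset.sum_le_sum fun x _ => ?_
  rw [← mul_assoc]
  by_cases hx : P' x = 0
  · have : P.real {x} = 0 := by by_contra h; exact hPP' x h hx
    simp [hx, this]
  refine mul_le_mul_of_nonneg_right (hlow x) ?_
  exact sum_mul_log_div_nonneg (fun y => measureReal_nonneg) (fun y => measureReal_nonneg)
    (by rw [sum_real_singleton, sum_real_singleton]) fun y => hac x y hx

end Perturbation

/-! ### Empirical types of words and pairs of words -/

section Types

variable {A B : Type*} [Fintype A] [Fintype B]

/-- The rows of an array of counts, normalized; a row of zeros stays a row of zeros. -/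
noncomputable def rowNormalize (κ : A → B → ℕ) (a : A) (b : B) : ℝ := κ a b / ∑ b', (κ a b' : ℝ)

lemma rowNormalize_nonneg (κ : A → B → ℕ) (a : A) (b : B) : 0 ≤ rowNormalize κ a b := by
  unfold rowNormalize; positivity

lemma sum_rowNormalize_le_one (κ : A → B → ℕ) (a : A) : ∑ b, rowNormalize κ a b ≤ 1 := by
  simp only [rowNormalize, ← Finset.sum_div]
  exact div_self_le_one _

lemma sum_rowNormalize (κ : A → B → ℕ) (a : A) (h : ∑ b', (κ a b' : ℝ) ≠ 0) :
    ∑ b, rowNormalize κ a b = 1 := by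
  simp only [rowNormalize, ← Finset.sum_div]
  exact div_self h

variable [DecidableEq A] [DecidableEq B] {ι : Type*} [Fintype ι]

/-- The number of positions at which two words carry a given pair of letters. -/
def pairCount (c : ι → A) (w : ι → B) (a : A) (b : B) : ℕ :=
  (Finset.univ.filter fun k => c k = a ∧ w k = b).card

lemma sum_comp_pair (c : ι → A) (w : ι → B) (F : A → B → ℝ) :
    ∑ k, F (c k) (w k) = ∑ a, ∑ b, (pairCount c w a b : ℝ) * F a b := by
  have h : ∀ a b, (pairCount c w a b : ℝ) * F a b =
      ∑ k, if c k = a ∧ w k = b then F a b else 0 := by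
    intro a b
    rw [pairCount, ← Finset.sum_filter, Finset.sum_const, nsmul_eq_mul]
  simp only [h]
  rw [Finset.sum_congr rfl fun a _ => Finset.sum_comm, Finset.sum_comm]
  refine Finset.sum_congr rfl fun k _ => ?_
  rw [Finset.sum_eq_single (c k), Finset.sum_eq_single (w k)]
  · simp
  · intro b _ hb; simp [hb.symm]
  · simp
  · intro a _ ha; simp [ha.symm]
  · simp

lemma pairCount_pos (c : ι → A) (w : ι → B) (k : ι) : 0 < pairCount c w (c k) (w k) :=
  Finset.card_pos.2 ⟨k, by simp⟩

lemma pairCount_le (c : ι → A) (w : ι → B) (a : A) (b : B) :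
    pairCount c w a b ≤ Fintype.card ι := Finset.card_le_univ _

lemma pairCount_comm (c : ι → A) (w : ι → B) (a : A) (b : B) :
    pairCount c w a b = pairCount w c b a := by
  simp only [pairCount, and_comm]

lemma sum_pairCount_right (c : ι → A) (w : ι → B) (a : A) :
    ∑ b, pairCount c w a b = (Finset.univ.filter fun k => c k = a).card := by
  rw [Finset.card_eq_sum_card_fiberwise (f := w) (t := Finset.univ) fun _ _ => by simp]
  simp only [pairCount, Finset.filter_filter]

lemma log_prod_div {f g : ι → ℝ} (hf : ∀ k, 0 < f k) (hg : ∀ k, 0 < g k) :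
    ∑ k, Real.log (f k / g k) = Real.log (∏ k, f k) - Real.log (∏ k, g k) := by
  rw [Real.log_prod fun k _ => (hf k).ne', Real.log_prod fun k _ => (hg k).ne',
    ← Finset.sum_sub_distrib]
  exact Finset.sum_congr rfl fun k _ => Real.log_div (hf k).ne' (hg k).ne'

end Types

/-! ### Outputs rejected on the full window are unlikely under the channel -/

section Miss

variable {X Y : Type*} [Fintype X] [DecidableEq X] [MeasurableSpace X]
  [MeasurableSingletonClass X] [Fintype Y] [DecidableEq Y] [MeasurableSpace Y]
  [MeasurableSingletonClass Y]

/-- The letter counts `n` of a word of length `N` agree with `N P` up to a factor `1 ± η`. -/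
def TypeClose (P : Measure X) (η : ℝ) (N : ℕ) (n : X → ℕ) : Prop :=
  ∀ x, |(n x : ℝ) - N * P.real {x}| ≤ η * (N * P.real {x})

/-- An output word that fails one of the two likelihood tests against the empirical
distributions is exponentially less likely under the channel than under its own conditional
type. -/
lemma likelihood_le_of_fail (Q : Kernel X Y) [IsMarkovKernel Q] (star : X)
    (P : Measure X) [IsProbabilityMeasure P] {α η a a₀ b b₀ : ℝ} (hη0 : 0 ≤ η) (hη : η < 1)
    (ha : ∀ V : Kernel X Y, IsMarkovKernel V → klDiv (P ⊗ₘ V).snd (Q star) < ENNReal.ofReal a₀ →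
      ENNReal.ofReal α < klDiv (P ⊗ₘ V).snd (P ⊗ₘ Q).snd)
    (hb : ∀ V : Kernel X Y, IsMarkovKernel V → mutualInfo (P ⊗ₘ V) ≤ ENNReal.ofReal b₀ →
      ENNReal.ofReal α < klDiv (P ⊗ₘ V) (P ⊗ₘ Q))
    (haη : a = 0 ∨ (a + (-Real.log (1 - η) + η / (1 - η) *
      (Fintype.card Y * (1 + ∑ y, |Real.log ((Q star).real {y})|))) < a₀ ∧ 0 < a₀))
    (hbη : (1 - η)⁻¹ * b ≤ b₀) {N : ℕ} (hN : 0 < N)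
    (c : Fin N → X) (w : Fin N → Y)
    (hc : TypeClose P η N fun x => (Finset.univ.filter fun k => c k = x).card)
    (hfail : Real.exp (-(a * N)) * ∏ k, rowNormalize (fun _ : Unit => fun y =>
        (Finset.univ.filter fun k => w k = y).card) () (w k) < ∏ k, (Q star).real {w k} ∨
      Real.exp (-(b * N)) * ∏ k, rowNormalize (pairCount w c) (w k) (c k) <
        ∏ k, P.real {c k}) :
    ∏ k, (Q (c k)).real {w k} ≤
      Real.exp (-((1 - η) * α * N)) * ∏ k, rowNormalize (pairCount c w) (c k) (w k) := by
  have hNR : (0 : ℝ) < N := by exact_mod_cast hN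
  have hVpos : ∀ k, 0 < rowNormalize (pairCount c w) (c k) (w k) := fun k => by
    have h : (0 : ℝ) < pairCount c w (c k) (w k) := by exact_mod_cast pairCount_pos c w k
    exact div_pos h (Finset.sum_pos' (fun _ _ => Nat.cast_nonneg _) ⟨w k, Finset.mem_univ _, h⟩)
  by_cases hQ0 : ∏ k, (Q (c k)).real {w k} = 0
  · rw [hQ0]
    exact mul_nonneg (Real.exp_pos _).le (Finset.prod_nonneg fun k _ => (hVpos k).le)
  have hQpos : ∀ k, 0 < (Q (c k)).real {w k} := fun k =>
    measureReal_nonneg.lt_of_ne' (Finset.prod_ne_zero_iff.1 hQ0 k (Finset.mem_univ k))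
  set n : X → ℕ := fun x => (Finset.univ.filter fun k => c k = x).card with hn
  set m : Y → ℕ := fun y => (Finset.univ.filter fun k => w k = y).card with hm
  have hnsum : ∀ x, ∑ y, (pairCount c w x y : ℝ) = n x := fun x => by
    rw [← Nat.cast_sum, sum_pairCount_right]
  have hmsum : ∀ y, ∑ x, (pairCount w c y x : ℝ) = m y := fun y => by
    rw [← Nat.cast_sum, sum_pairCount_right]
  have hntot : ∑ x, (n x : ℝ) = N := by
    rw [← Nat.cast_sum, hn, ← Finset.card_eq_sum_card_fiberwise fun _ _ => by simp]
    simp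
  have hmtot : ∑ y, (m y : ℝ) = N := by
    rw [← Nat.cast_sum, hm, ← Finset.card_eq_sum_card_fiberwise fun _ _ => by simp]
    simp
  set P' : X → ℝ := fun x => n x / N with hP'
  have hP'1 : ∑ x, P' x = 1 := by rw [← Finset.sum_div, hntot, div_self hNR.ne']
  have hP'0 : ∀ x, 0 ≤ P' x := fun x => by positivity
  have hlow : ∀ x, (1 - η) * P.real {x} ≤ P' x := fun x => by
    rw [hP', le_div_iff₀ hNR]
    have := (abs_le.1 (hc x)).1
    nlinarith
  have hup : ∀ x, P' x ≤ (1 + η) * P.real {x} := fun x => by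
    rw [hP', div_le_iff₀ hNR]
    have := (abs_le.1 (hc x)).2
    nlinarith
  -- the conditional type, completed to a Markov kernel
  let v : X → Y → ℝ := fun x y =>
    if n x = 0 then (Q x).real {y} else rowNormalize (pairCount c w) x y
  have hv0 : ∀ x y, 0 ≤ v x y := fun x y => by
    simp only [v]; split_ifs
    · exact measureReal_nonneg
    · exact rowNormalize_nonneg _ _ _
  have hv1 : ∀ x, ∑ y, v x y = 1 := fun x => by
    simp only [v]; split_ifs with h
    · exact sum_real_singleton _
    · exact sum_rowNormalize _ _ (by rw [hnsum]; exact_mod_cast h)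
  let V : Kernel X Y := ⟨fun x => measureOfWeights (v x), Measurable.of_discrete⟩
  have hVM : IsMarkovKernel V := ⟨fun x => isProbabilityMeasure_measureOfWeights (hv0 x) (hv1 x)⟩
  have hV : ∀ x y, (V x).real {y} = v x y := fun x y =>
    measureOfWeights_real_singleton (hv0 x) y
  have hPV : ∀ x y, P' x * v x y = pairCount c w x y / N := fun x y => by
    simp only [P', v]
    split_ifs with h
    · have h1 : (pairCount c w x y : ℝ) ≤ n x := by
        rw [← hnsum]
        exact Finset.single_le_sum (f := fun y => (pairCount c w x y : ℝ))
          (fun _ _ => Nat.cast_nonneg _) (Finset.mem_univ y)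
      rw [h] at h1 ⊢
      have : (pairCount c w x y : ℝ) = 0 := le_antisymm (by simpa using h1) (Nat.cast_nonneg _)
      simp [this]
    · have : (n x : ℝ) ≠ 0 := by exact_mod_cast h
      rw [rowNormalize, hnsum]
      field_simp
  have hmean : ∀ F : X → Y → ℝ, ∑ x, P' x * ∑ y, v x y * F x y = (∑ k, F (c k) (w k)) / N := by
    intro F
    rw [sum_comp_pair c w F, Finset.sum_div]
    refine Finset.sum_congr rfl fun x _ => ?_
    rw [Finset.mul_sum, Finset.sum_div]
    refine Finset.sum_congr rfl fun y _ => ?_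
    rw [← mul_assoc, hPV]; ring
  set q : Y → ℝ := fun y => m y / N with hq
  have hqV : ∀ y, q y = ∑ x, P' x * (V x).real {y} := fun y => by
    simp only [hV, hPV, hq]
    rw [← Finset.sum_div, ← hmsum]
    simp only [pairCount_comm w c]
  have hncpos : ∀ k, 0 < n (c k) := fun k => Finset.card_pos.2 ⟨k, by simp⟩
  have hmwpos : ∀ k, 0 < m (w k) := fun k => Finset.card_pos.2 ⟨k, by simp⟩
  have hvc : ∀ k, v (c k) (w k) = rowNormalize (pairCount c w) (c k) (w k) := fun k => by
    simp only [v, if_neg (hncpos k).ne']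
  have hqpos : ∀ k, 0 < q (w k) := fun k => div_pos (by exact_mod_cast hmwpos k) hNR
  have hac : ∀ x y, P' x ≠ 0 → (Q x).real {y} = 0 → (V x).real {y} = 0 := by
    intro x y hx hy
    have h1 := hPV x y
    rw [hV]
    by_contra hne
    have h2 : (pairCount c w x y : ℝ) ≠ 0 := by
      intro h0
      rw [h0, zero_div] at h1
      exact (mul_ne_zero hx hne) h1
    obtain ⟨k, hk⟩ := Finset.card_pos.1 (Nat.pos_of_ne_zero (by exact_mod_cast h2 :
      pairCount c w x y ≠ 0))
    simp only [Finset.mem_filter, Finset.mem_univ, true_and] at hk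
    have := hQpos k
    rw [hk.1, hk.2, hy] at this
    exact lt_irrefl _ this
  have hkl : ENNReal.ofReal α < klDiv (P ⊗ₘ V) (P ⊗ₘ Q) := by
    rcases hfail with hfail | hfail
    · have hpr : 0 < ∏ k, (Q star).real {w k} := by
        refine lt_of_le_of_lt (mul_nonneg (Real.exp_pos _).le
          (Finset.prod_nonneg fun k _ => rowNormalize_nonneg _ _ _)) hfail
      have hspos : ∀ k, 0 < (Q star).real {w k} := fun k =>
        measureReal_nonneg.lt_of_ne' (Finset.prod_ne_zero_iff.1 hpr.ne' k (Finset.mem_univ k))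
      have hrn : ∀ k, rowNormalize (fun _ : Unit => m) () (w k) = q (w k) := fun k => by
        simp only [rowNormalize, hmtot, hq]
      simp only [hrn] at hfail
      have hlog := Real.log_lt_log (mul_pos (Real.exp_pos _)
        (Finset.prod_pos fun k _ => hqpos k)) hfail
      rw [Real.log_mul (Real.exp_pos _).ne' (Finset.prod_pos fun k _ => hqpos k).ne',
        Real.log_exp] at hlog
      have hsum := log_prod_div hqpos hspos
      have hD : ∑ y, q y * Real.log (q y / (Q star).real {y}) < a := by
        have h1 : ∑ y, q y * Real.log (q y / (Q star).real {y}) =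
            (∑ k, Real.log (q (w k) / (Q star).real {w k})) / N := by
          rw [← hmean fun _ y => Real.log (q y / (Q star).real {y})]
          simp only [hqV, hV, Finset.sum_mul, Finset.mul_sum]
          rw [Finset.sum_comm]
          simp only [mul_assoc]
        rw [h1, div_lt_iff₀ hNR]
        linarith
      have hqac : ∀ y, (Q star).real {y} = 0 → q y = 0 := by
        intro y hy
        by_contra hne
        have h2 : m y ≠ 0 := by
          intro h0
          simp [hq, h0] at hne
        obtain ⟨k, hk⟩ := Finset.card_pos.1 (Nat.pos_of_ne_zero h2)
        simp only [Finset.mem_filter, Finset.mem_univ, true_and] at hk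
        have := hspos k
        rw [hk, hy] at this
        exact lt_irrefl _ this
      -- With threshold exponent `a = 0` the output test cannot fail, since a divergence is
      -- nonnegative.
      have ha' : a + (-Real.log (1 - η) + η / (1 - η) *
          (Fintype.card Y * (1 + ∑ y, |Real.log ((Q star).real {y})|))) < a₀ ∧ 0 < a₀ := by
        refine haη.resolve_left fun h0 => ?_
        have : 0 ≤ ∑ y, q y * Real.log (q y / (Q star).real {y}) :=
          sum_mul_log_div_nonneg (fun y => by positivity) (fun y => measureReal_nonneg)
            (by rw [sum_real_singleton, ← Finset.sum_div, hmtot, div_self hNR.ne']) hqac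
        linarith
      have hlt : klDiv (P ⊗ₘ V).snd (Q star) < ENNReal.ofReal a₀ := by
        refine (klDiv_snd_le_of_close P V hη0 hη hP'1 hlow hup (Q star) hqV hqac).trans_lt ?_
        rw [ENNReal.ofReal_lt_ofReal_iff ha'.2]
        linarith [ha'.1]
      -- Data processing: condition (a) bounds the output marginals, and the joint divergence is at
      -- least as large.
      exact (ha V hVM hlt).trans_le (klDiv_map_le _ _ measurable_snd)
    · have hpr : 0 < ∏ k, P.real {c k} := by
        refine lt_of_le_of_lt (mul_nonneg (Real.exp_pos _).le
          (Finset.prod_nonneg fun k _ => rowNormalize_nonneg _ _ _)) hfail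
      have hPpos : ∀ k, 0 < P.real {c k} := fun k =>
        measureReal_nonneg.lt_of_ne' (Finset.prod_ne_zero_iff.1 hpr.ne' k (Finset.mem_univ k))
      -- Bayes' rule for empirical laws: the backward type is the input type times the empirical
      -- information ratio `v / q`.
      have hW : ∀ k, rowNormalize (pairCount w c) (w k) (c k) =
          P' (c k) * (v (c k) (w k) / q (w k)) := fun k => by
        rw [← mul_div_assoc, hPV, rowNormalize, hmsum, pairCount_comm]
        simp only [hq]
        have : (m (w k) : ℝ) ≠ 0 := by exact_mod_cast (hmwpos k).ne'
        field_simp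
      have hP'pos : ∀ k, 0 < P' (c k) := fun k => div_pos (by exact_mod_cast hncpos k) hNR
      have hvqpos : ∀ k, 0 < v (c k) (w k) / q (w k) := fun k =>
        div_pos (by rw [hvc]; exact hVpos k) (hqpos k)
      simp only [hW, Finset.prod_mul_distrib] at hfail
      have h1 := Finset.prod_pos fun k (_ : k ∈ Finset.univ) => hP'pos k
      have h2 := Finset.prod_pos fun k (_ : k ∈ Finset.univ) => hvqpos k
      have hlog := Real.log_lt_log (mul_pos (Real.exp_pos _) (mul_pos h1 h2)) hfail
      rw [Real.log_mul (Real.exp_pos _).ne' (mul_pos h1 h2).ne', Real.log_mul h1.ne' h2.ne',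
        Real.log_exp, Real.log_prod (fun k _ => (hvqpos k).ne')] at hlog
      have hsum := log_prod_div hP'pos hPpos
      -- Failure of the input test bounds the empirical mutual information plus the divergence of
      -- `P'` from `P`; the latter is nonnegative and can be dropped.
      have hG : 0 ≤ ∑ k, Real.log (P' (c k) / P.real {c k}) := by
        have h3 : 0 ≤ ∑ x, P' x * Real.log (P' x / P.real {x}) := by
          refine sum_mul_log_div_nonneg hP'0 (fun x => measureReal_nonneg)
            (by rw [sum_real_singleton, hP'1]) fun x hx => ?_
          have := hup x
          rw [hx, mul_zero] at this
          exact le_antisymm this (hP'0 x)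
        have h4 := hmean fun x _ => Real.log (P' x / P.real {x})
        simp only [← Finset.sum_mul, hv1, one_mul] at h4
        rw [h4] at h3
        by_contra! hneg
        exact absurd h3 (not_le.2 (div_neg_of_neg_of_pos hneg hNR))
      have hI : ∑ x, P' x * ∑ y, v x y * Real.log (v x y / q y) < b := by
        rw [hmean fun x y => Real.log (v x y / q y), div_lt_iff₀ hNR]
        linarith
      refine hb V hVM ((mutualInfo_le_of_close P V hη hP'0 hP'1 hlow hqV).trans
        (ENNReal.ofReal_le_ofReal ?_))
      simp only [hV]
      exact (mul_le_mul_of_nonneg_left hI.le (inv_nonneg.2 (by linarith))).trans hbη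
  have hmain := le_sum_of_lt_klDiv_of_close P V Q hη hlow hac hkl
  simp only [hV] at hmain
  rw [hmean fun x y => Real.log (v x y / (Q x).real {y}), le_div_iff₀ hNR] at hmain
  simp only [hvc] at hmain
  rw [log_prod_div hVpos hQpos] at hmain
  have hp1 := Finset.prod_pos fun k (_ : k ∈ Finset.univ) => hVpos k
  have hp2 := Finset.prod_pos fun k (_ : k ∈ Finset.univ) => hQpos k
  rw [← Real.log_le_log_iff hp2 (mul_pos (Real.exp_pos _) hp1),
    Real.log_mul (Real.exp_pos _).ne' hp1.ne', Real.log_exp]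
  linarith

end Miss

/-! ### Stopping at the first time at which a local test is passed -/

section SequentialDecoder

variable {X Y : Type*} [Finite Y] [MeasurableSpace Y] [MeasurableSingletonClass Y]

/-- Over a finite alphabet every set of words of fixed finite length is measurable, so being
determined by the past is enough. -/
lemma measurableSet_piLE_of_dependsOn {n : ℕ} {S : Set (ℕ → Y)}
    (h : ∀ y y' : ℕ → Y, (∀ j ≤ n, y j = y' j) → y ∈ S → y' ∈ S) :
    MeasurableSet[Filtration.piLE (X := fun _ : ℕ => Y) n] S := by
  refine ⟨Preorder.restrictLe n '' S, (Set.toFinite _).measurableSet, ?_⟩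
  refine Set.Subset.antisymm ?_ (Set.subset_preimage_image _ _)
  rintro y ⟨y', hy', heq⟩
  exact h y' y (fun j hj => congrFun heq ⟨j, hj⟩) hy'

variable {M N : ℕ} [NeZero M] (pass : ℕ → (ℕ → Y) → Fin M → Prop) (T : ℕ)

/-- The first time at which some message passes the test, or `T` if there is none before. -/
noncomputable def firstPass (y : ℕ → Y) : ℕ :=
  sInf {n | (∃ m, pass n y m) ∨ T ≤ n}

/-- A message that passes the test at the decision time. -/
noncomputable def firstPassDecision (y : ℕ → Y) : Fin M :=
  Classical.epsilon (pass (firstPass pass T y) y)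

lemma firstPass_mem (y : ℕ → Y) : (∃ m, pass (firstPass pass T y) y m) ∨ T ≤ firstPass pass T y :=
  Nat.sInf_mem (s := {n | (∃ m, pass n y m) ∨ T ≤ n}) ⟨T, Or.inr le_rfl⟩

lemma firstPass_le (y : ℕ → Y) : firstPass pass T y ≤ T :=
  Nat.sInf_le (Or.inr le_rfl)

variable {pass T}

lemma firstPass_le_of_pass {n : ℕ} {y : ℕ → Y} {m : Fin M} (h : pass n y m) :
    firstPass pass T y ≤ n :=
  Nat.sInf_le (Or.inl ⟨m, h⟩)

/-- A pass no later than the deadline `T` ensures that the decoder stops because of a pass. Even if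
it stops exactly at `T`, that very pass occurs there, so the choice made by `epsilon` is meaningful.
-/
lemma pass_firstPassDecision {n : ℕ} (hn : n ≤ T) {y : ℕ → Y} {m : Fin M} (h : pass n y m) :
    pass (firstPass pass T y) y (firstPassDecision pass T y) := by
  refine Classical.epsilon_spec (p := pass (firstPass pass T y) y) ?_
  rcases firstPass_mem pass T y with h' | h'
  · exact h'
  · have h1 : firstPass pass T y = n := le_antisymm (firstPass_le_of_pass h) (hn.trans h')
    exact ⟨m, h1 ▸ h⟩

lemma firstPass_congr (hlocal : ∀ n y y', (∀ j ≤ n, y j = y' j) → pass n y = pass n y')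
    {y y' : ℕ → Y} (h : ∀ j ≤ firstPass pass T y, y j = y' j) :
    firstPass pass T y' = firstPass pass T y := by
  have key : ∀ n ≤ firstPass pass T y, (((∃ m, pass n y m) ∨ T ≤ n) ↔
      ((∃ m, pass n y' m) ∨ T ≤ n)) := fun n hn => by
    rw [hlocal n y y' fun j hj => h j (hj.trans hn)]
  have hle : firstPass pass T y' ≤ firstPass pass T y :=
    Nat.sInf_le ((key _ le_rfl).1 (firstPass_mem pass T y))
  exact le_antisymm hle (Nat.sInf_le ((key _ hle).2 (firstPass_mem pass T y')))

/-- The block code that stops at the first time at which some message passes the test. -/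
noncomputable def sequentialCode (codeword : Fin M → Fin N → X)
    (hlocal : ∀ n y y', (∀ j ≤ n, y j = y' j) → pass n y = pass n y') (T : ℕ) :
    BlockCode X Y M N where
  codeword := codeword
  decTime := firstPass pass T
  isStoppingTime := fun n => measurableSet_piLE_of_dependsOn fun y y' h hy => by
    have hy' : firstPass pass T y ≤ n := by simpa using hy
    have := firstPass_congr hlocal fun j hj => h j (hj.trans hy')
    simpa [this] using hy
  decision := firstPassDecision pass T
  measurable_decision := @measurable_to_countable' _ _ _ _ (_) _ fun m => by
    have hloc : ∀ n y y', (∀ j ≤ n, y j = y' j) → firstPass pass T y ≤ n →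
        firstPass pass T y' = firstPass pass T y ∧
          firstPassDecision pass T y' = firstPassDecision pass T y := by
      intro n y y' h hy
      have h1 := firstPass_congr hlocal fun j hj => h j (hj.trans hy)
      refine ⟨h1, ?_⟩
      rw [firstPassDecision, firstPassDecision, h1,
        hlocal _ y y' fun j hj => h j (hj.trans hy)]
    have hmeas : ∀ n : ℕ, MeasurableSet[Filtration.piLE (X := fun _ : ℕ => Y) n]
        (firstPassDecision pass T ⁻¹' {m} ∩
          {y | ((firstPass pass T y : ℕ) : WithTop ℕ) ≤ (n : WithTop ℕ)}) := by
      intro n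
      refine measurableSet_piLE_of_dependsOn ?_
      rintro y y' h ⟨h1, h2⟩
      have h2' : firstPass pass T y ≤ n := by simpa using h2
      obtain ⟨h3, h4⟩ := hloc n y y' h h2'
      refine ⟨?_, ?_⟩
      · simpa [h4] using h1
      · simpa [h3] using h2
    refine ⟨?_, hmeas⟩
    -- The decoder never stops after `T`, so the event is already decided at time `T`, and hence
    -- lies in the supremum of the filtration.
    have h1 : firstPassDecision pass T ⁻¹' {m} = firstPassDecision pass T ⁻¹' {m} ∩
        {y | ((firstPass pass T y : ℕ) : WithTop ℕ) ≤ (T : WithTop ℕ)} :=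
      (Set.inter_eq_left.2 fun y _ => by simpa using firstPass_le pass T y).symm
    rw [h1]
    exact le_iSup (fun n => Filtration.piLE (X := fun _ : ℕ => Y) n) T _ (hmeas T)

end SequentialDecoder

/-! ### Delay and error of the two-window decoder -/

section TwoWindows

variable {X Y : Type*} [MeasurableSpace X] [Finite Y] [MeasurableSpace Y]
  [MeasurableSingletonClass Y] {M N : ℕ} [NeZero M]

/-- The word of a message passes the test `t` in a window of one of the lengths `n₀`, `N` that
ends at a given time. -/
def windowPass (t : ℕ → (Fin N → X) → (Fin N → Y) → Prop) (n₀ : ℕ) (C : Fin M → Fin N → X)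
    (n : ℕ) (y : ℕ → Y) (m : Fin M) : Prop :=
  ∃ i ∈ ({n₀, N} : Finset ℕ), ∃ s, s + i = n + 1 ∧ t i (C m) (window N s y)

/-- The decoder that tests windows of two lengths and stops at the latest at time `T`. -/
lemma exists_windowCode (Q : Kernel X Y) [IsMarkovKernel Q] (star : X)
    (t : ℕ → (Fin N → X) → (Fin N → Y) → Prop)
    (ht : ∀ i c w w', (∀ k : Fin N, k.val < i → w k = w' k) → t i c w = t i c w')
    {n₀ : ℕ} (hn₀ : 1 ≤ n₀) (hn₀N : n₀ ≤ N) (A : ℕ) (C : Fin M → Fin N → X) {p₁ p₂ : ℝ≥0∞}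
    (hp₁ : ∀ m, (Measure.pi fun k => Q (C m k)) {w | ¬ t n₀ (C m) w} ≤ p₁)
    (hp₂ : ∀ m, (Measure.pi fun k => Q (C m k)) {w | ¬ t N (C m) w} ≤ p₂) :
    ∃ D : BlockCode X Y M N, D.codeword = C ∧
      (∀ m, ∀ l < A, ∫⁻ y, ((D.decTime y - l : ℕ) : ℝ≥0∞) ∂(outputLaw Q star (C m) l)
        ≤ n₀ + N * p₁ + A * p₂) ∧
      ∀ m, ∀ l < A, outputLaw Q star (C m) l {y | D.decision y ≠ m} ≤ p₁ +
        ∑ m' ∈ Finset.univ.erase m, ∑ i ∈ ({n₀, N} : Finset ℕ), ∑ s ∈ Finset.range (A + N + 1),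
          outputLaw Q star (C m) l {y | window N s y ∈ {w | t i (C m') w}} := by
  classical
  have hlocal : ∀ n (y y' : ℕ → Y), (∀ j ≤ n, y j = y' j) →
      windowPass t n₀ C n y = windowPass t n₀ C n y' := by
    intro n y y' h
    funext m
    have : ∀ i s, s + i = n + 1 → t i (C m) (window N s y) = t i (C m) (window N s y') :=
      fun i s hs => ht _ _ _ _ fun k hk => h _ (by omega)
    simp only [windowPass, eq_iff_iff]
    refine exists_congr fun i => and_congr_right fun _ => exists_congr fun s =>
      and_congr_right fun hs => by rw [this i s hs]
  have hlaw : ∀ m l, ∀ S : Set (Fin N → Y), outputLaw Q star (C m) l {y | window N l y ∈ S} =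
      (Measure.pi fun k => Q (C m k)) S := by
    intro m l S
    rw [outputLaw_window]
    simp only [channelInput_add]
  have hmeas : ∀ s, ∀ S : Set (Fin N → Y), MeasurableSet {y : ℕ → Y | window N s y ∈ S} :=
    fun s S => measurable_window N s (Set.toFinite S).measurableSet
  have hpass : ∀ m l i, i ∈ ({n₀, N} : Finset ℕ) → ∀ y, t i (C m) (window N l y) →
      windowPass t n₀ C (l + i - 1) y m := fun m l i hi y h => by
    have h1 : 1 ≤ i := by
      rcases Finset.mem_insert.1 hi with h | h
      · omega
      · rw [Finset.mem_singleton] at h; omega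
    exact ⟨i, hi, l, by omega, h⟩
  -- The deadline `A + N` lies beyond the end of every possible transmission, the last of which
  -- starts at time `A - 1`.
  refine ⟨sequentialCode C hlocal (A + N), rfl, fun m l hl => ?_, fun m l hl => ?_⟩
  · set F₁ : Set (ℕ → Y) := {y | window N l y ∈ {w | ¬ t n₀ (C m) w}}
    set F₂ : Set (ℕ → Y) := {y | window N l y ∈ {w | ¬ t N (C m) w}}
    -- A pass on the true short window bounds the delay by `n₀`, one on the true full window by `N`.
    -- If both fail, the deadline leaves at most `A + N`, which is the sum of the two indicator
    -- terms.
    have hpt : ∀ y, ((firstPass (windowPass t n₀ C) (A + N) y - l : ℕ) : ℝ≥0∞) ≤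
        n₀ + (N * F₁.indicator 1 y + A * F₂.indicator 1 y) := by
      intro y
      by_cases h1 : t n₀ (C m) (window N l y)
      · have := firstPass_le_of_pass (T := A + N) (hpass m l n₀ (by simp) y h1)
        refine le_trans ?_ le_self_add
        exact_mod_cast (by omega)
      have hF₁ : F₁.indicator (1 : (ℕ → Y) → ℝ≥0∞) y = 1 := Set.indicator_of_mem h1 _
      rw [hF₁, mul_one]
      by_cases h2 : t N (C m) (window N l y)
      · have := firstPass_le_of_pass (T := A + N) (hpass m l N (by simp) y h2)
        refine le_trans ?_ (le_trans le_self_add le_add_self)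
        exact_mod_cast (by omega)
      · have hF₂ : F₂.indicator (1 : (ℕ → Y) → ℝ≥0∞) y = 1 := Set.indicator_of_mem h2 _
        have := firstPass_le (windowPass t n₀ C) (A + N) y
        rw [hF₂, mul_one]
        refine le_trans ?_ le_add_self
        exact_mod_cast (by omega)
    refine (lintegral_mono hpt).trans ?_
    have hm₁ : Measurable (F₁.indicator (1 : (ℕ → Y) → ℝ≥0∞)) :=
      measurable_one.indicator (hmeas _ _)
    have hm₂ : Measurable (F₂.indicator (1 : (ℕ → Y) → ℝ≥0∞)) :=
      measurable_one.indicator (hmeas _ _)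
    rw [lintegral_add_left measurable_const, lintegral_add_left (hm₁.const_mul _),
      lintegral_const_mul _ hm₁, lintegral_const_mul _ hm₂, lintegral_indicator_one (hmeas _ _),
      lintegral_indicator_one (hmeas _ _), hlaw, hlaw, lintegral_const, measure_univ, mul_one,
      ← add_assoc]
    gcongr
    · exact hp₁ m
    · exact hp₂ m
  · have hsub : {y | firstPassDecision (windowPass t n₀ C) (A + N) y ≠ m} ⊆
        {y | window N l y ∈ {w | ¬ t n₀ (C m) w}} ∪
        ⋃ m' ∈ Finset.univ.erase m, ⋃ i ∈ ({n₀, N} : Finset ℕ), ⋃ s ∈ Finset.range (A + N + 1),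
          {y | window N s y ∈ {w | t i (C m') w}} := by
      intro y hy
      by_cases h1 : t n₀ (C m) (window N l y)
      · right
        obtain ⟨i, hi, s, hs, hts⟩ := pass_firstPassDecision (T := A + N) (by omega)
          (hpass m l n₀ (by simp) y h1)
        have hle := firstPass_le (windowPass t n₀ C) (A + N) y
        simp only [Set.mem_iUnion]
        have hi1 : 1 ≤ i := by
          rcases Finset.mem_insert.1 hi with h | h
          · omega
          · rw [Finset.mem_singleton] at h; omega
        exact ⟨_, Finset.mem_erase.2 ⟨hy, Finset.mem_univ _⟩, i, hi, s,
          Finset.mem_range.2 (by omega), hts⟩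
      · exact Or.inl h1
    refine (measure_mono hsub).trans ((measure_union_le _ _).trans (add_le_add ?_ ?_))
    · rw [hlaw]; exact hp₁ m
    · refine (measure_biUnion_finset_le _ _).trans (Finset.sum_le_sum fun m' _ => ?_)
      refine (measure_biUnion_finset_le _ _).trans (Finset.sum_le_sum fun i _ => ?_)
      exact measure_biUnion_finset_le _ _

end TwoWindows

/-! ### The two likelihood tests and the random coding bound -/

section Tests

variable {N : ℕ}

/-- The positions of a word of length `N` that lie in its prefix of length `i`. -/
def prefixIndices (N i : ℕ) : Finset (Fin N) := Finset.univ.filter fun k => k.val < i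

lemma mem_prefixIndices {i : ℕ} {k : Fin N} : k ∈ prefixIndices N i ↔ k.val < i := by
  simp [prefixIndices]

lemma prefixIndices_self : prefixIndices N N = Finset.univ := by
  ext k; simp [mem_prefixIndices]

/-- Version of `pi_real_le_card_mul` in which only some of the coordinates are compared. -/
lemma pi_real_le_card_mul_of_finset {ι Z : Type*} [Fintype ι] [Fintype Z]
    [MeasurableSpace Z] [MeasurableSingletonClass Z] {J : Type*} [Fintype J] (μ : ι → Measure Z)
    [∀ k, IsProbabilityMeasure (μ k)] (S : Set (ι → Z)) {θ : ℝ} (hθ : 0 ≤ θ)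
    (ν : J → ι → Z → ℝ) (hν : ∀ j k z, 0 ≤ ν j k z) (hν1 : ∀ j k, ∑ z, ν j k z ≤ 1)
    (s : Finset ι)
    (h : ∀ z ∈ S, ∃ j, ∏ k ∈ s, (μ k).real {z k} ≤ θ * ∏ k ∈ s, ν j k (z k)) :
    (Measure.pi μ).real S ≤ Fintype.card J * θ := by
  classical
  -- Outside `s` the reference weights are those of `μ` itself, so these coordinates cancel from the
  -- comparison.
  refine pi_real_le_card_mul μ S hθ (fun j k z => if k ∈ s then ν j k z else (μ k).real {z})
    (fun j k z => ?_) (fun j k => ?_) fun z hz => ?_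
  · split_ifs
    · exact hν j k z
    · exact measureReal_nonneg
  · split_ifs
    · exact hν1 j k
    · exact (sum_real_singleton _).le
  · obtain ⟨j, hj⟩ := h z hz
    refine ⟨j, ?_⟩
    have h1 : ∏ k, (if k ∈ s then ν j k (z k) else (μ k).real {z k}) =
        (∏ k ∈ s, ν j k (z k)) * ∏ k ∈ sᶜ, (μ k).real {z k} := by
      rw [← Finset.prod_mul_prod_compl s]
      congr 1
      · exact Finset.prod_congr rfl fun k hk => if_pos hk
      · exact Finset.prod_congr rfl fun k hk => if_neg (Finset.mem_compl.1 hk)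
    rw [h1, ← Finset.prod_mul_prod_compl s, ← mul_assoc]
    exact mul_le_mul_of_nonneg_right hj (Finset.prod_nonneg fun _ _ => measureReal_nonneg)

variable {X Y : Type*} {J₁ J₂ : Type*}

/-- The first `i` letters of `w` are likelier, by a factor `1 / θ`, under some `q j` than
under `μ`. -/
def OutputTest (μ : Y → ℝ) (q : J₁ → Y → ℝ) (θ : ℝ) (i : ℕ) (w : Fin N → Y) : Prop :=
  ∃ j, ∏ k ∈ prefixIndices N i, μ (w k) ≤ θ * ∏ k ∈ prefixIndices N i, q j (w k)

/-- The first `i` letters of `c` are likelier, by a factor `1 / θ`, as the outcome of some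
channel `W j` with input `w` than under `μ`. -/
def InputTest (μ : X → ℝ) (W : J₂ → Y → X → ℝ) (θ : ℝ) (i : ℕ) (c : Fin N → X)
    (w : Fin N → Y) : Prop :=
  ∃ j, ∏ k ∈ prefixIndices N i, μ (c k) ≤ θ * ∏ k ∈ prefixIndices N i, W j (w k) (c k)

lemma OutputTest.congr {μ : Y → ℝ} {q : J₁ → Y → ℝ} {θ : ℝ} {i : ℕ} {w w' : Fin N → Y}
    (h : ∀ k : Fin N, k.val < i → w k = w' k) : OutputTest μ q θ i w = OutputTest μ q θ i w' := by
  have h1 : ∀ f : Y → ℝ, ∏ k ∈ prefixIndices N i, f (w k) = ∏ k ∈ prefixIndices N i, f (w' k) :=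
    fun f => Finset.prod_congr rfl fun k hk => by rw [h k (mem_prefixIndices.1 hk)]
  simp only [OutputTest, h1]

lemma InputTest.congr {μ : X → ℝ} {W : J₂ → Y → X → ℝ} {θ : ℝ} {i : ℕ} {c : Fin N → X}
    {w w' : Fin N → Y} (h : ∀ k : Fin N, k.val < i → w k = w' k) :
    InputTest μ W θ i c w = InputTest μ W θ i c w' := by
  have h1 : ∀ j, ∏ k ∈ prefixIndices N i, W j (w k) (c k) =
      ∏ k ∈ prefixIndices N i, W j (w' k) (c k) :=
    fun j => Finset.prod_congr rfl fun k hk => by rw [h k (mem_prefixIndices.1 hk)]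
  simp only [InputTest, h1]

variable [Fintype X] [MeasurableSpace X] [MeasurableSingletonClass X]
  [Fintype Y] [MeasurableSpace Y] [MeasurableSingletonClass Y] [Fintype J₁] [Fintype J₂]

/-- The window law `lam` does not depend on the tested word `c`. By Tonelli the window can therefore
be fixed first, and the input test becomes a change of measure for a random word. The output event
factors out, so the gains of the two tests multiply. The factor 2 comes from conditioning on typical
words. -/
lemma lintegral_test_le (P : Measure X) [IsProbabilityMeasure P] {W : J₂ → Y → X → ℝ}
    (hW0 : ∀ j y x, 0 ≤ W j y x) (hW1 : ∀ j y, ∑ x, W j y x ≤ 1) {θ : ℝ} (hθ : 0 ≤ θ)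
    (O : Set (Fin N → Y)) (i : ℕ) (ρ : Measure (Fin N → X)) [IsProbabilityMeasure ρ]
    (hρ : ∀ S, ρ S ≤ 2 * Measure.pi (fun _ => P) S) (lam : Measure (Fin N → Y))
    [IsProbabilityMeasure lam] :
    ∫⁻ c, lam {w | w ∈ O ∧ InputTest (fun x => P.real {x}) W θ i c w} ∂ρ ≤
      ENNReal.ofReal (2 * (Fintype.card J₂ * θ)) * lam O := by
  classical
  have h1 : ∀ c, lam {w | w ∈ O ∧ InputTest (fun x => P.real {x}) W θ i c w} =
      ∫⁻ w, O.indicator (fun w =>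
        {c | InputTest (fun x => P.real {x}) W θ i c w}.indicator 1 c) w ∂lam := by
    intro c
    rw [← lintegral_indicator_one (Set.toFinite _).measurableSet]
    refine lintegral_congr fun w => ?_
    by_cases hO : w ∈ O <;> by_cases hI : InputTest (fun x => P.real {x}) W θ i c w <;>
      simp [Set.indicator, hO, hI]
  simp only [h1]
  rw [lintegral_lintegral_swap (Measurable.of_discrete.aemeasurable),
    ← lintegral_indicator_one (Set.toFinite O).measurableSet,
    ← lintegral_const_mul _ Measurable.of_discrete]
  refine lintegral_mono fun w => ?_
  by_cases hO : w ∈ O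
  · simp only [Set.indicator_of_mem hO, Pi.one_apply, mul_one]
    rw [lintegral_indicator_one (Set.toFinite _).measurableSet]
    refine (hρ _).trans ?_
    rw [ENNReal.ofReal_mul (by norm_num), ENNReal.ofReal_ofNat]
    gcongr
    rw [← ofReal_measureReal]
    refine ENNReal.ofReal_le_ofReal ?_
    exact pi_real_le_card_mul_of_finset (fun _ => P) _ hθ (fun j k x => W j (w k) x)
      (fun j k x => hW0 j _ x) (fun j k => hW1 j _) (prefixIndices N i) fun c hc => hc
  · simp [Set.indicator_of_notMem hO]

lemma card_straddling_le (A N l : ℕ) :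
    ((Finset.range (A + N + 1)).filter fun s => ¬ (s + N ≤ l ∨ l + N ≤ s)).card ≤ 2 * N := by
  have : ((Finset.range (A + N + 1)).filter fun s => ¬ (s + N ≤ l ∨ l + N ≤ s)) ⊆
      Finset.Ico (l + 1 - N) (l + N) := by
    intro s hs
    simp only [Finset.mem_filter, Finset.mem_Ico] at hs ⊢
    omega
  refine (Finset.card_le_card this).trans ?_
  rw [Nat.card_Ico]
  omega

/-- Random coding with the two-window decoder. -/
lemma exists_code (Q : Kernel X Y) [IsMarkovKernel Q] (star : X) (P : Measure X)
    [IsProbabilityMeasure P] {q : J₁ → Y → ℝ} (hq0 : ∀ j y, 0 ≤ q j y)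
    (hq1 : ∀ j, ∑ y, q j y ≤ 1) {W : J₂ → Y → X → ℝ} (hW0 : ∀ j y x, 0 ≤ W j y x)
    (hW1 : ∀ j y, ∑ x, W j y x ≤ 1) {θ₁ θ₂ : ℝ} (hθ₁ : 0 ≤ θ₁) (hθ₂ : 0 ≤ θ₂)
    {t : ℕ → (Fin N → X) → (Fin N → Y) → Prop}
    (ht : ∀ i c w, t i c w ↔ OutputTest (fun y => (Q star).real {y}) q θ₁ i w ∧
      InputTest (fun x => P.real {x}) W θ₂ i c w)
    {n₀ : ℕ} (hn₀ : 1 ≤ n₀) (hn₀N : n₀ ≤ N) {A M : ℕ} (hA : A ≠ 0) (hM : M ≠ 0)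
    (G : Set (Fin N → X)) (hG : 1 / 2 ≤ (Measure.pi fun _ : Fin N => P).real G) {p₁ p₂ : ℝ}
    (hp₁0 : 0 ≤ p₁) (hp₂0 : 0 ≤ p₂)
    (hp₁ : ∀ c ∈ G, (Measure.pi fun k => Q (c k)).real {w | ¬ t n₀ c w} ≤ p₁)
    (hp₂ : ∀ c ∈ G, (Measure.pi fun k => Q (c k)).real {w | ¬ t N c w} ≤ p₂) :
    ∃ D : BlockCode X Y M N,
      D.errorProb Q star A ≤ ENNReal.ofReal (p₁ + M * (2 *
        ((A + N + 1) * (2 * (Fintype.card J₂ * θ₂) * (Fintype.card J₁ * θ₁)) +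
          2 * N * (2 * (Fintype.card J₂ * θ₂))))) ∧
      D.expectedDelay Q star A ≤ ENNReal.ofReal (n₀ + N * p₁ + A * p₂) := by
  classical
  have : NeZero M := ⟨hM⟩
  set π := Measure.pi fun _ : Fin N => P with hπ
  have hGm : MeasurableSet G := (Set.toFinite G).measurableSet
  have hG2 : (2 : ℝ≥0∞)⁻¹ ≤ π G := by
    have h1 := ENNReal.ofReal_le_ofReal hG
    rw [ofReal_measureReal, one_div, ENNReal.ofReal_inv_of_pos two_pos] at h1
    simpa using h1
  have hG0 : π G ≠ 0 := fun h => by simp [h] at hG2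
  -- Conditioning on the typical set makes every chosen codeword typical, and multiplies
  -- probabilities by at most 2 because `G` has mass at least one half.
  let ρ : Measure (Fin N → X) := ProbabilityTheory.cond π G
  have hρprob : IsProbabilityMeasure ρ := ProbabilityTheory.cond_isProbabilityMeasure hG0
  have hρ : ∀ S, ρ S ≤ 2 * π S := fun S => by
    simp only [ρ]
    rw [ProbabilityTheory.cond_apply hGm]
    gcongr
    · exact ENNReal.inv_le_iff_inv_le.1 hG2
    · exact Set.inter_subset_right
  have hρG : ρ Gᶜ = 0 := by
    simp only [ρ]
    rw [ProbabilityTheory.cond_apply hGm, Set.inter_compl_self, measure_empty, mul_zero]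
  set E₁ : ℝ≥0∞ := ENNReal.ofReal (2 * (Fintype.card J₂ * θ₂)) with hE₁
  set E₂ : ℝ≥0∞ := ENNReal.ofReal (Fintype.card J₁ * θ₁) with hE₂
  set B : ℝ≥0∞ := 2 * ((A + N + 1) * (E₁ * E₂) + 2 * N * E₁) with hB
  let f : (Fin N → X) → (Fin N → X) → ℝ≥0∞ := fun c c' => (A : ℝ≥0∞)⁻¹ * ∑ l ∈ Finset.range A,
    ∑ i ∈ ({n₀, N} : Finset ℕ), ∑ s ∈ Finset.range (A + N + 1),
      outputLaw Q star c l {y | window N s y ∈ {w | t i c' w}}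
  have hA' : (A : ℝ≥0∞) ≠ 0 := by exact_mod_cast hA
  have hM' : (M : ℝ≥0∞) ≠ 0 := by exact_mod_cast hM
  have hwin : ∀ (c : Fin N → X) (l i s : ℕ), ∫⁻ c', outputLaw Q star c l {y | window N s y ∈ {w | t i c' w}} ∂ρ ≤
      E₁ * E₂ + if ¬ (s + N ≤ l ∨ l + N ≤ s) then E₁ else 0 := by
    intro c l i s
    set lam := Measure.pi fun k : Fin N => Q (channelInput star c l (s + k)) with hlam
    have h1 : ∫⁻ c', outputLaw Q star c l {y | window N s y ∈ {w | t i c' w}} ∂ρ ≤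
        E₁ * lam {w | OutputTest (fun y => (Q star).real {y}) q θ₁ i w} := by
      simp only [outputLaw_window]
      refine le_trans (le_of_eq ?_) (lintegral_test_le P hW0 hW1 hθ₂
        {w | OutputTest (fun y => (Q star).real {y}) q θ₁ i w} i ρ hρ lam)
      simp only [ht]
      rfl
    refine h1.trans ?_
    -- A window disjoint from the transmission is pure noise and gains the output test factor `E₂`.
    -- When the window meets the transmission, the output test is bounded trivially by one.
    by_cases h : s + N ≤ l ∨ l + N ≤ s
    swap
    · rw [if_pos h]
      exact (mul_le_of_le_one_right' prob_le_one).trans le_add_self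
    · rw [if_neg (not_not.2 h), add_zero]
      gcongr
      have hst : lam = Measure.pi fun _ : Fin N => Q star := by
        rw [hlam]
        congr 1
        funext k
        rw [channelInput_of_lt_or_le]
        have := k.2
        omega
      rw [hst, ← ofReal_measureReal]
      refine ENNReal.ofReal_le_ofReal ?_
      exact pi_real_le_card_mul_of_finset (fun _ => Q star) _ hθ₁ (fun j _ y => q j y)
        (fun j _ y => hq0 j y) (fun j _ => hq1 j) (prefixIndices N i) fun w hw => hw
  have hfB : ∀ c, ∫⁻ c', f c c' ∂ρ ≤ B := by
    intro c
    simp only [f]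
    rw [lintegral_const_mul _ Measurable.of_discrete,
      lintegral_finsetSum _ fun _ _ => Measurable.of_discrete]
    have hl : ∀ l ∈ Finset.range A, ∫⁻ c', ∑ i ∈ ({n₀, N} : Finset ℕ),
        ∑ s ∈ Finset.range (A + N + 1),
          outputLaw Q star c l {y | window N s y ∈ {w | t i c' w}} ∂ρ ≤ B := by
      intro l _
      rw [lintegral_finsetSum _ fun _ _ => Measurable.of_discrete]
      have hi : ∀ i ∈ ({n₀, N} : Finset ℕ), ∫⁻ c', ∑ s ∈ Finset.range (A + N + 1),
          outputLaw Q star c l {y | window N s y ∈ {w | t i c' w}} ∂ρ ≤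
            (A + N + 1) * (E₁ * E₂) + 2 * N * E₁ := by
        intro i _
        rw [lintegral_finsetSum _ fun _ _ => Measurable.of_discrete]
        refine (Finset.sum_le_sum fun s _ => hwin c l i s).trans ?_
        rw [Finset.sum_add_distrib, Finset.sum_const, Finset.card_range, nsmul_eq_mul,
          ← Finset.sum_filter, Finset.sum_const, nsmul_eq_mul]
        gcongr
        · push_cast; exact le_rfl
        · exact_mod_cast card_straddling_le A N l
      refine (Finset.sum_le_card_nsmul _ _ _ hi).trans ?_
      rw [nsmul_eq_mul, hB]
      gcongr
      exact_mod_cast Finset.card_le_two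
    refine (mul_le_mul_right (Finset.sum_le_card_nsmul _ _ _ hl) _).trans ?_
    rw [Finset.card_range, nsmul_eq_mul, ← mul_assoc,
      ENNReal.inv_mul_cancel hA' (ENNReal.natCast_ne_top A), one_mul]
  obtain ⟨C, hCG, hC⟩ := exists_codebook ρ f B hfB G hρG M
  have htlocal : ∀ i c w w', (∀ k : Fin N, k.val < i → w k = w' k) → t i c w = t i c w' := by
    intro i c w w' h
    rw [eq_iff_iff, ht, ht, OutputTest.congr h, InputTest.congr h]
  have hconv : ∀ {p : ℝ}, ∀ {c : Fin N → X} {S : Set (Fin N → Y)},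
      (Measure.pi fun k => Q (c k)).real S ≤ p →
      (Measure.pi fun k => Q (c k)) S ≤ ENNReal.ofReal p := fun h => by
    rw [← ofReal_measureReal]; exact ENNReal.ofReal_le_ofReal h
  obtain ⟨D, hDC, hDdelay, hDerr⟩ := exists_windowCode Q star t htlocal hn₀ hn₀N A C
    (fun m => hconv (hp₁ _ (hCG m))) (fun m => hconv (hp₂ _ (hCG m)))
  have havg : ∀ K : ℝ≥0∞, (A : ℝ≥0∞)⁻¹ * (M : ℝ≥0∞)⁻¹ * (M * (A * K)) = K := fun K => by
    rw [show (A : ℝ≥0∞)⁻¹ * (M : ℝ≥0∞)⁻¹ * (M * (A * K)) =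
      ((A : ℝ≥0∞)⁻¹ * A) * ((M : ℝ≥0∞)⁻¹ * M) * K by ring,
      ENNReal.inv_mul_cancel hA' (ENNReal.natCast_ne_top A),
      ENNReal.inv_mul_cancel hM' (ENNReal.natCast_ne_top M), one_mul, one_mul]
  refine ⟨D, ?_, ?_⟩
  · have hBreal : ENNReal.ofReal (p₁ + M * (2 *
        ((A + N + 1) * (2 * (Fintype.card J₂ * θ₂) * (Fintype.card J₁ * θ₁)) +
          2 * N * (2 * (Fintype.card J₂ * θ₂))))) = ENNReal.ofReal p₁ + M * B := by
      rw [ENNReal.ofReal_add hp₁0 (by positivity), ENNReal.ofReal_mul (by positivity),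
        ENNReal.ofReal_mul (by positivity), ENNReal.ofReal_add (by positivity) (by positivity),
        ENNReal.ofReal_mul (by positivity),
        ENNReal.ofReal_mul (p := 2 * (Fintype.card J₂ * θ₂)) (by positivity),
        ENNReal.ofReal_mul (p := 2 * (N : ℝ)) (by positivity), ENNReal.ofReal_add (by positivity)
        one_pos.le, ENNReal.ofReal_add (by positivity) (by positivity),
        ENNReal.ofReal_mul (p := 2) (q := (N : ℝ)) (by positivity)]
      simp only [ENNReal.ofReal_natCast, ENNReal.ofReal_ofNat, ENNReal.ofReal_one, hB, hE₁, hE₂]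
    rw [hBreal]
    unfold BlockCode.errorProb
    rw [hDC]
    calc (A : ℝ≥0∞)⁻¹ * (M : ℝ≥0∞)⁻¹ * ∑ m, ∑ l ∈ Finset.range A,
          outputLaw Q star (C m) l {y | D.decision y ≠ m}
        ≤ (A : ℝ≥0∞)⁻¹ * (M : ℝ≥0∞)⁻¹ * ∑ m, ∑ l ∈ Finset.range A, (ENNReal.ofReal p₁ +
          ∑ m' ∈ Finset.univ.erase m, ∑ i ∈ ({n₀, N} : Finset ℕ),
            ∑ s ∈ Finset.range (A + N + 1),
              outputLaw Q star (C m) l {y | window N s y ∈ {w | t i (C m') w}}) := by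
          gcongr with m _ l hl
          exact hDerr m l (Finset.mem_range.1 hl)
      _ = (A : ℝ≥0∞)⁻¹ * (M : ℝ≥0∞)⁻¹ * (M * (A * ENNReal.ofReal p₁) +
            A * ∑ m, ∑ m' ∈ Finset.univ.erase m, f (C m) (C m')) := by
          congr 1
          simp only [Finset.sum_add_distrib, Finset.sum_const, Finset.card_range, nsmul_eq_mul,
            Finset.card_univ, Fintype.card_fin, f, ← Finset.mul_sum]
          rw [← mul_assoc (A : ℝ≥0∞) (A : ℝ≥0∞)⁻¹,
            ENNReal.mul_inv_cancel hA' (ENNReal.natCast_ne_top A), one_mul]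
          congr 1
          exact Finset.sum_congr rfl fun m _ => Finset.sum_comm
      _ ≤ (A : ℝ≥0∞)⁻¹ * (M : ℝ≥0∞)⁻¹ * (M * (A * ENNReal.ofReal p₁) + A * (M * (M * B))) := by
          gcongr
      _ = (A : ℝ≥0∞)⁻¹ * (M : ℝ≥0∞)⁻¹ * (M * (A * (ENNReal.ofReal p₁ + M * B))) := by
          ring
      _ = _ := havg _
  · have hdreal : ENNReal.ofReal (n₀ + N * p₁ + A * p₂) =
        n₀ + N * ENNReal.ofReal p₁ + A * ENNReal.ofReal p₂ := by
      rw [ENNReal.ofReal_add (by positivity) (by positivity), ENNReal.ofReal_add (by positivity)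
        (by positivity), ENNReal.ofReal_mul (by positivity), ENNReal.ofReal_mul (by positivity)]
      simp only [ENNReal.ofReal_natCast]
    rw [hdreal]
    unfold BlockCode.expectedDelay
    rw [hDC]
    calc (A : ℝ≥0∞)⁻¹ * (M : ℝ≥0∞)⁻¹ * ∑ m, ∑ l ∈ Finset.range A,
          ∫⁻ y, ((D.decTime y - l : ℕ) : ℝ≥0∞) ∂(outputLaw Q star (C m) l)
        ≤ (A : ℝ≥0∞)⁻¹ * (M : ℝ≥0∞)⁻¹ * ∑ m : Fin M, ∑ l ∈ Finset.range A,
          (n₀ + N * ENNReal.ofReal p₁ + A * ENNReal.ofReal p₂) := by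
          gcongr with m _ l hl
          exact hDdelay m l (Finset.mem_range.1 hl)
      _ = _ := by
          simp only [Finset.sum_const, Finset.card_range, nsmul_eq_mul,
            Finset.card_univ, Fintype.card_fin]
          exact havg _

end Tests

/-! ### Typical codewords and concentration of scores -/

section Typicality

variable {X Y : Type*} [Fintype X] [DecidableEq X] [MeasurableSpace X]
  [MeasurableSingletonClass X] [Fintype Y] [DecidableEq Y] [MeasurableSpace Y]
  [MeasurableSingletonClass Y] {N : ℕ}

/-- The number of times a letter occurs in the prefix of length `i` of a word. -/
def prefixCount (c : Fin N → X) (i : ℕ) (x : X) : ℕ :=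
  ((prefixIndices N i).filter fun k => c k = x).card

lemma sum_prefixIndices_comp (c : Fin N → X) (i : ℕ) (F : X → ℝ) :
    ∑ k ∈ prefixIndices N i, F (c k) = ∑ x, (prefixCount c i x : ℝ) * F x := by
  rw [← Finset.sum_fiberwise (prefixIndices N i) c]
  refine Finset.sum_congr rfl fun x _ => ?_
  rw [prefixCount, ← nsmul_eq_mul, ← Finset.sum_const]
  exact Finset.sum_congr rfl fun k hk => by rw [(Finset.mem_filter.1 hk).2]

lemma pi_null_of_real_singleton_eq_zero {ι Z : Type*} [Fintype ι] [Fintype Z] [MeasurableSpace Z]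
    [MeasurableSingletonClass Z] (μ : ι → Measure Z) [∀ k, IsProbabilityMeasure (μ k)] :
    (Measure.pi μ) {w | ∃ k, (μ k).real {w k} = 0} = 0 := by
  rw [show {w : ι → Z | ∃ k, (μ k).real {w k} = 0} =
    ⋃ k, Function.eval k ⁻¹' {z | (μ k).real {z} = 0} by ext; simp]
  refine measure_iUnion_null fun k => ?_
  rw [(measurePreserving_eval μ k).measure_preimage
    (Set.toFinite _).measurableSet.nullMeasurableSet,
    ← Set.biUnion_of_singleton {z | (μ k).real {z} = 0},
    measure_biUnion_null_iff (Set.to_countable _)]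
  intro z hz
  simpa [measureReal_def, ENNReal.toReal_eq_zero_iff] using hz

/-- A word drawn from `P` has a prefix of atypical type only with small probability. -/
lemma pi_real_not_typeClose_le (P : Measure X) [IsProbabilityMeasure P] {η β : ℝ} (hη : 0 < η)
    (hβ : 0 < β) (hN : 0 < N) {i : ℕ} (hi : β * N ≤ i) (hiN : i ≤ N) :
    (Measure.pi fun _ : Fin N => P).real {c | ¬ TypeClose P η i (prefixCount c i)} ≤
      ∑ x, 2 / (N * (η * β * P.real {x}) ^ 2) := by
  have hNR : (0 : ℝ) < N := by exact_mod_cast hN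
  set π := Measure.pi fun _ : Fin N => P
  have hsub : {c : Fin N → X | ¬ TypeClose P η i (prefixCount c i)} ⊆ ⋃ x ∈ Finset.univ,
      {c : Fin N → X | ¬ |(prefixCount c i x : ℝ) - i * P.real {x}| ≤ η * (i * P.real {x})} := by
    intro c hc
    simp only [TypeClose, Set.mem_ofPred_eq, not_forall] at hc
    simpa using hc
  refine (measureReal_mono hsub (measure_ne_top _ _)).trans
    ((measureReal_biUnion_finset_le _ _).trans
    (Finset.sum_le_sum fun x _ => ?_))
  rcases (measureReal_nonneg (μ := P) (s := {x})).eq_or_lt with hx | hx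
  · rw [← hx]
    have hnull : π {c : Fin N → X | ¬ |(prefixCount c i x : ℝ) - i * 0| ≤ η * (i * 0)} = 0 := by
      refine measure_mono_null ?_ (pi_null_of_real_singleton_eq_zero fun _ : Fin N => P)
      intro c hc
      by_contra hne
      refine hc ?_
      have h0 : prefixCount c i x = 0 := by
        refine Finset.card_eq_zero.2 (Finset.filter_eq_empty_iff.2 fun k _ hk => hne ⟨k, ?_⟩)
        rw [hk, hx]
      simp [h0]
    rw [measureReal_def, hnull]
    simp
  · have hipos : (0 : ℝ) < i := lt_of_lt_of_le (by positivity) hi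
    set s := η * (i * P.real {x}) with hs
    have hspos : 0 < s := by positivity
    -- The sign `e = ±1` lets the one-sided Chebyshev bound cover both tails.
    let g : ℝ → Fin N → X → ℝ := fun e k z => if k ∈ prefixIndices N i ∧ z = x then e else 0
    have hgK : ∀ e : ℝ, |e| = 1 → ∀ k z, |g e k z| ≤ 1 := fun e he k z => by
      simp only [g]; split_ifs <;> simp [he]
    have hgsum : ∀ e (c : Fin N → X), ∑ k, g e k (c k) = e * prefixCount c i x := fun e c => by
      simp only [g, prefixCount, ite_and]
      rw [← Finset.sum_filter, Finset.filter_mem_eq_inter, Finset.univ_inter, ← Finset.sum_filter,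
        Finset.sum_const, nsmul_eq_mul, mul_comm]
    have hcard : (prefixIndices N i).card = i := by
      rw [prefixIndices, Fin.card_filter_val_lt, min_eq_right hiN]
    have hgint : ∀ e, ∑ k, ∫ z, g e k z ∂P = e * (i * P.real {x}) := fun e => by
      have h1 : ∀ k, ∫ z, g e k z ∂P = if k ∈ prefixIndices N i then e * P.real {x} else 0 := by
        intro k
        rw [integral_fintype Integrable.of_finite]
        simp only [g, ite_and]
        split_ifs
        · simp [mul_comm]
        · simp
      simp only [h1]
      rw [← Finset.sum_filter, Finset.filter_mem_eq_inter, Finset.univ_inter, Finset.sum_const,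
        hcard, nsmul_eq_mul]
      ring
    have hb : ∀ e : ℝ, |e| = 1 →
        π.real {c | e * (prefixCount c i x : ℝ) ≤ e * (i * P.real {x}) - s} ≤ N / s ^ 2 := by
      intro e he
      have := pi_real_sum_le_sub (fun _ : Fin N => P) (g e) (hgK e he) hspos
      simpa only [hgsum, hgint, Fintype.card_fin, one_pow, mul_one] using this
    have hcov : {c : Fin N → X | ¬ |(prefixCount c i x : ℝ) - i * P.real {x}| ≤ s} ⊆
        {c | 1 * (prefixCount c i x : ℝ) ≤ 1 * (i * P.real {x}) - s} ∪
        {c | -1 * (prefixCount c i x : ℝ) ≤ -1 * (i * P.real {x}) - s} := by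
      intro c hc
      simp only [Set.mem_ofPred_eq, not_le, lt_abs] at hc
      rcases hc with h | h
      · right; simp only [Set.mem_ofPred_eq]; linarith
      · left; simp only [Set.mem_ofPred_eq]; linarith
    refine (measureReal_mono hcov).trans ((measureReal_union_le _ _).trans
      ((add_le_add (hb 1 (by simp)) (hb (-1) (by simp))).trans ?_))
    have hsN : η * β * P.real {x} * N ≤ s := by
      rw [hs]
      nlinarith [mul_le_mul_of_nonneg_left hi (mul_pos hη hx).le]
    have h1 : N / s ^ 2 ≤ N / (η * β * P.real {x} * N) ^ 2 := by gcongr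
    have h2 : N / (η * β * P.real {x} * N) ^ 2 = 1 / (N * (η * β * P.real {x}) ^ 2) := by
      field_simp
    rw [h2] at h1
    calc N / s ^ 2 + N / s ^ 2 ≤ 1 / (N * (η * β * P.real {x}) ^ 2) +
          1 / (N * (η * β * P.real {x}) ^ 2) := add_le_add h1 h1
      _ = _ := by ring

/-- Lower deviations of an additive score over the prefix of a word of typical type. -/
lemma pi_real_score_le (Q : Kernel X Y) [IsMarkovKernel Q] (P : Measure X)
    [IsProbabilityMeasure P] {η : ℝ} {c : Fin N → X} {i : ℕ}
    (hc : TypeClose P η i (prefixCount c i)) (g : X → Y → ℝ) {K s : ℝ}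
    (hK : ∀ x y, |g x y| ≤ K) (hs : 0 < s) :
    (Measure.pi fun k => Q (c k)).real {w | ∑ k ∈ prefixIndices N i, g (c k) (w k) ≤
      i * (∑ x, P.real {x} * ∑ y, (Q x).real {y} * g x y - η * K) - s} ≤ N * K ^ 2 / s ^ 2 := by
  by_cases hX : IsEmpty X
  · have := P.eq_zero_of_isEmpty
    exact absurd this (IsProbabilityMeasure.ne_zero P)
  by_cases hY : IsEmpty Y
  · obtain ⟨x⟩ := not_isEmpty_iff.1 hX
    exact absurd (Q x).eq_zero_of_isEmpty (IsProbabilityMeasure.ne_zero (Q x))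
  obtain ⟨x₀⟩ := not_isEmpty_iff.1 hX
  obtain ⟨y₀⟩ := not_isEmpty_iff.1 hY
  have hK0 : 0 ≤ K := (abs_nonneg _).trans (hK x₀ y₀)
  let f : Fin N → Y → ℝ := fun k y => if k ∈ prefixIndices N i then g (c k) y else 0
  have hfK : ∀ k y, |f k y| ≤ K := fun k y => by
    simp only [f]; split_ifs
    · exact hK _ _
    · simpa using hK0
  let mg : X → ℝ := fun x => ∑ y, (Q x).real {y} * g x y
  have hmg : ∀ x, |mg x| ≤ K := fun x => by
    refine (Finset.abs_sum_le_sum_abs _ _).trans ?_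
    calc ∑ y, |(Q x).real {y} * g x y| ≤ ∑ y, (Q x).real {y} * K := by
          refine Finset.sum_le_sum fun y _ => ?_
          rw [abs_mul, abs_of_nonneg measureReal_nonneg]
          exact mul_le_mul_of_nonneg_left (hK x y) measureReal_nonneg
      _ = K := by rw [← Finset.sum_mul, sum_real_singleton, one_mul]
  have hsumf : ∀ w : Fin N → Y, ∑ k, f k (w k) = ∑ k ∈ prefixIndices N i, g (c k) (w k) := by
    intro w
    simp only [f]
    rw [← Finset.sum_filter, Finset.filter_mem_eq_inter, Finset.univ_inter]
  -- The mean score given the codeword depends only on its letter counts, which typicality then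
  -- compares with `P`.
  have hint : ∑ k, ∫ y, f k y ∂(Q (c k)) = ∑ x, (prefixCount c i x : ℝ) * mg x := by
    rw [← sum_prefixIndices_comp]
    have : ∀ k, ∫ y, f k y ∂(Q (c k)) = if k ∈ prefixIndices N i then mg (c k) else 0 := by
      intro k
      simp only [f]
      split_ifs
      · rw [integral_fintype Integrable.of_finite]
        rfl
      · simp
    simp only [this]
    rw [← Finset.sum_filter, Finset.filter_mem_eq_inter, Finset.univ_inter]
  have hlow : i * (∑ x, P.real {x} * mg x - η * K) ≤ ∑ x, (prefixCount c i x : ℝ) * mg x := by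
    have h1 : ∀ x, i * P.real {x} * mg x - η * (i * P.real {x}) * K ≤
        (prefixCount c i x : ℝ) * mg x := by
      intro x
      have h2 : |((prefixCount c i x : ℝ) - i * P.real {x}) * mg x| ≤
          η * (i * P.real {x}) * K := by
        rw [abs_mul]
        exact mul_le_mul (hc x) (hmg x) (abs_nonneg _) ((abs_nonneg _).trans (hc x))
      have := (abs_le.1 h2).1
      nlinarith
    refine le_trans (le_of_eq ?_) (Finset.sum_le_sum fun x _ => h1 x)
    rw [Finset.sum_sub_distrib, ← Finset.sum_mul, ← Finset.mul_sum, ← Finset.mul_sum,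
      sum_real_singleton, mul_sub, Finset.mul_sum]
    simp only [mul_assoc]
    ring
  refine le_trans (measureReal_mono ?_)
    ((pi_real_sum_le_sub (fun k => Q (c k)) f hfK hs).trans (by simp))
  intro w hw
  simp only [Set.mem_ofPred_eq, hsumf, hint] at hw ⊢
  exact hw.trans (by linarith)

end Typicality

/-! ### The decoder's test and its failure probabilities -/

section WindowTest

variable {X Y : Type*} [Fintype X] [DecidableEq X] [MeasurableSpace X]
  [MeasurableSingletonClass X] [Fintype Y] [DecidableEq Y] [MeasurableSpace Y]
  [MeasurableSingletonClass Y] {N : ℕ}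

/-- The output distributions that the decoder compares with noise: that of the channel with
input `P`, and all types of length at most `N`. -/
noncomputable def outputFamily (P : Measure X) (Q : Kernel X Y) (N : ℕ) :
    Option (Y → Fin (N + 1)) → Y → ℝ
  | none => fun y => (P ⊗ₘ Q).snd.real {y}
  | some κ => rowNormalize (fun _ : Unit => fun y => (κ y).val) ()

/-- The backward channels that the decoder tests: that of the channel with input `P`, and all
conditional types. -/
noncomputable def inputFamily (P : Measure X) (Q : Kernel X Y) (N : ℕ) :
    Option (Y → X → Fin (N + 1)) → Y → X → ℝ
  | none => fun y x => P.real {x} * (Q x).real {y} / (P ⊗ₘ Q).snd.real {y}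
  | some κ => rowNormalize (fun y x => (κ y x).val)

variable (P : Measure X) [IsProbabilityMeasure P] (Q : Kernel X Y) [IsMarkovKernel Q] (star : X)

lemma outputFamily_nonneg (j : Option (Y → Fin (N + 1))) (y : Y) :
    0 ≤ outputFamily P Q N j y := by
  rcases j with _ | κ
  · exact measureReal_nonneg
  · exact rowNormalize_nonneg (fun _ : Unit => fun y => (κ y).val) () y

lemma sum_outputFamily_le_one (j : Option (Y → Fin (N + 1))) :
    ∑ y, outputFamily P Q N j y ≤ 1 := by
  rcases j with _ | κ
  · exact (sum_real_singleton _).le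
  · exact sum_rowNormalize_le_one (fun _ : Unit => fun y => (κ y).val) ()

lemma inputFamily_nonneg (j : Option (Y → X → Fin (N + 1))) (y : Y) (x : X) :
    0 ≤ inputFamily P Q N j y x := by
  rcases j with _ | κ
  · exact div_nonneg (mul_nonneg measureReal_nonneg measureReal_nonneg) measureReal_nonneg
  · exact rowNormalize_nonneg (fun y x => (κ y x).val) y x

lemma sum_inputFamily_le_one (j : Option (Y → X → Fin (N + 1))) (y : Y) :
    ∑ x, inputFamily P Q N j y x ≤ 1 := by
  rcases j with _ | κ
  · simp only [inputFamily]
    rw [← Finset.sum_div, ← compProd_snd_real_singleton]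
    exact div_self_le_one _
  · exact sum_rowNormalize_le_one (fun y x => (κ y x).val) y

/-- The test that the decoder applies to a window, with likelihood ratios `e ^ (a N)` and
`e ^ (b N)`. -/
def WindowTest (a b : ℝ) (i : ℕ) (c : Fin N → X) (w : Fin N → Y) : Prop :=
  OutputTest (fun y => (Q star).real {y}) (outputFamily P Q N) (Real.exp (-(a * N))) i w ∧
    InputTest (fun x => P.real {x}) (inputFamily P Q N) (Real.exp (-(b * N))) i c w

variable {P Q star}

lemma prefixCount_self (c : Fin N → X) :
    prefixCount c N = fun x => (Finset.univ.filter fun k => c k = x).card := by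
  funext x
  rw [prefixCount, prefixIndices_self]

/-- The probability that a full window fails the test. -/
lemma pi_real_not_windowTest_self_le {α η a a₀ b b₀ : ℝ} (hη0 : 0 ≤ η) (hη : η < 1)
    (ha : ∀ V : Kernel X Y, IsMarkovKernel V → klDiv (P ⊗ₘ V).snd (Q star) < ENNReal.ofReal a₀ →
      ENNReal.ofReal α < klDiv (P ⊗ₘ V).snd (P ⊗ₘ Q).snd)
    (hb : ∀ V : Kernel X Y, IsMarkovKernel V → mutualInfo (P ⊗ₘ V) ≤ ENNReal.ofReal b₀ →
      ENNReal.ofReal α < klDiv (P ⊗ₘ V) (P ⊗ₘ Q))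
    (haη : a = 0 ∨ (a + (-Real.log (1 - η) + η / (1 - η) *
      (Fintype.card Y * (1 + ∑ y, |Real.log ((Q star).real {y})|))) < a₀ ∧ 0 < a₀))
    (hbη : (1 - η)⁻¹ * b ≤ b₀) (hN : 0 < N)
    {c : Fin N → X} (hc : TypeClose P η N (prefixCount c N)) :
    (Measure.pi fun k => Q (c k)).real {w | ¬ WindowTest P Q star a b N c w} ≤
      Fintype.card (X → Y → Fin (N + 1)) * Real.exp (-((1 - η) * α * N)) := by
  refine pi_real_le_card_mul (fun k => Q (c k)) _ (Real.exp_pos _).le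
    (fun κ k y => rowNormalize (fun x y => (κ x y).val) (c k) y)
    (fun κ k y => rowNormalize_nonneg _ _ _) (fun κ k => sum_rowNormalize_le_one _ _) ?_
  intro w hw
  -- The reference channel is the conditional type of `w` given `c`; counting these types gives the
  -- polynomial factor.
  refine ⟨fun x y => ⟨pairCount c w x y, 
    Nat.lt_succ_of_le ((pairCount_le c w x y).trans (by simp))⟩, ?_⟩
  refine likelihood_le_of_fail Q star P hη0 hη ha hb haη hbη hN c w ?_ ?_
  · rwa [prefixCount_self] at hc
  · simp only [Set.mem_ofPred_eq, WindowTest, not_and_or, OutputTest, InputTest, not_exists, not_le,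
      prefixIndices_self] at hw
    -- Failing a test means failing against every reference, in particular against the types of the
    -- pair itself.
    rcases hw with hw | hw
    · left
      exact hw (some fun y => ⟨(Finset.univ.filter fun k => w k = y).card,
        Nat.lt_succ_of_le ((Finset.card_le_univ _).trans (by simp))⟩)
    · right
      exact hw (some fun y x => ⟨pairCount w c y x,
        Nat.lt_succ_of_le ((pairCount_le w c y x).trans (by simp))⟩)

/-- The log-likelihood ratio of an output letter against noise, set to `L` where it is infinite. -/
noncomputable def outputScore (P : Measure X) (Q : Kernel X Y) (star : X) (L : ℝ) (y : Y) : ℝ :=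
  if (Q star).real {y} = 0 then L else Real.log ((P ⊗ₘ Q).snd.real {y} / (Q star).real {y})

/-- The information density of the channel `Q` with input `P`. -/
noncomputable def infoDensity (P : Measure X) (Q : Kernel X Y) (x : X) (y : Y) : ℝ :=
  Real.log ((Q x).real {y} / (P ⊗ₘ Q).snd.real {y})

/-- The reference `none` is the law induced by `P` and `Q`, and its log-likelihood ratios are sums
of the two scores. A letter impossible under noise makes the noise likelihood zero, so the output
test then holds whatever `L` is. -/
lemma windowTest_of_score {a b L : ℝ} {i : ℕ} {c : Fin N → X} {w : Fin N → Y}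
    (hc : ∀ k, P.real {c k} ≠ 0) (hw : ∀ k, (Q (c k)).real {w k} ≠ 0)
    (h₁ : a * N ≤ ∑ k ∈ prefixIndices N i, outputScore P Q star L (w k))
    (h₂ : b * N ≤ ∑ k ∈ prefixIndices N i, infoDensity P Q (c k) (w k)) :
    WindowTest P Q star a b i c w := by
  have hp : ∀ k, 0 < (P ⊗ₘ Q).snd.real {w k} := fun k => snd_real_ne_zero P Q (hc k) (hw k)
  have hPc : ∀ k, 0 < P.real {c k} := fun k => measureReal_nonneg.lt_of_ne' (hc k)
  have hQw : ∀ k, 0 < (Q (c k)).real {w k} := fun k => measureReal_nonneg.lt_of_ne' (hw k)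
  refine ⟨⟨none, ?_⟩, ⟨none, ?_⟩⟩
  · by_cases h0 : ∃ k ∈ prefixIndices N i, (Q star).real {w k} = 0
    · obtain ⟨k, hk, hk0⟩ := h0
      rw [Finset.prod_eq_zero hk hk0]
      exact mul_nonneg (Real.exp_pos _).le
        (Finset.prod_nonneg fun k _ => outputFamily_nonneg P Q _ _)
    · push Not at h0
      have hs : ∀ k ∈ prefixIndices N i, 0 < (Q star).real {w k} := fun k hk =>
        measureReal_nonneg.lt_of_ne' (h0 k hk)
      have h1 : ∑ k ∈ prefixIndices N i, outputScore P Q star L (w k) =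
          Real.log (∏ k ∈ prefixIndices N i, (P ⊗ₘ Q).snd.real {w k}) -
            Real.log (∏ k ∈ prefixIndices N i, (Q star).real {w k}) := by
        rw [Real.log_prod fun k _ => (hp k).ne', Real.log_prod fun k hk => (hs k hk).ne',
          ← Finset.sum_sub_distrib]
        refine Finset.sum_congr rfl fun k hk => ?_
        rw [outputScore, if_neg (h0 k hk), Real.log_div (hp k).ne' (h0 k hk)]
      have hpp := Finset.prod_pos fun k (_ : k ∈ prefixIndices N i) => hp k
      have hsp := Finset.prod_pos hs
      simp only [outputFamily]
      rw [← Real.log_le_log_iff hsp (mul_pos (Real.exp_pos _) hpp),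
        Real.log_mul (Real.exp_pos _).ne' hpp.ne', Real.log_exp]
      linarith
  · have h1 : ∑ k ∈ prefixIndices N i, infoDensity P Q (c k) (w k) =
        Real.log (∏ k ∈ prefixIndices N i,
          P.real {c k} * (Q (c k)).real {w k} / (P ⊗ₘ Q).snd.real {w k}) -
          Real.log (∏ k ∈ prefixIndices N i, P.real {c k}) := by
      rw [Real.log_prod fun k _ => (hPc k).ne',
        Real.log_prod fun k _ => (div_pos (mul_pos (hPc k) (hQw k)) (hp k)).ne',
        ← Finset.sum_sub_distrib]
      refine Finset.sum_congr rfl fun k _ => ?_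
      rw [infoDensity, mul_div_assoc, Real.log_mul (hc k) (div_pos (hQw k) (hp k)).ne']
      ring
    have hpp := Finset.prod_pos fun k (_ : k ∈ prefixIndices N i) => hPc k
    have hsp := Finset.prod_pos fun k (_ : k ∈ prefixIndices N i) =>
      div_pos (mul_pos (hPc k) (hQw k)) (hp k)
    simp only [inputFamily]
    rw [← Real.log_le_log_iff hpp (mul_pos (Real.exp_pos _) hsp),
      Real.log_mul (Real.exp_pos _).ne' hsp.ne', Real.log_exp]
    linarith

/-- The probability that a short window fails the test. -/
lemma pi_real_not_windowTest_le {η a b L K σ β : ℝ} (hN : 0 < N) {i : ℕ} (hi : β * N ≤ i)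
    {c : Fin N → X} (hc : TypeClose P η i (prefixCount c i))
    (hcN : TypeClose P η N (prefixCount c N)) (hσ : 0 < σ)
    (hK₁ : ∀ y, |outputScore P Q star L y| ≤ K) (hK₂ : ∀ x y, |infoDensity P Q x y| ≤ K)
    {D I : ℝ} (hD : D = ∑ x, P.real {x} * ∑ y, (Q x).real {y} * outputScore P Q star L y)
    (hI : I = ∑ x, P.real {x} * ∑ y, (Q x).real {y} * infoDensity P Q x y)
    (hD0 : 0 ≤ D - η * K) (hI0 : 0 ≤ I - η * K)
    (ha : a + σ < β * (D - η * K)) (hb : b + σ < β * (I - η * K)) :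
    (Measure.pi fun k => Q (c k)).real {w | ¬ WindowTest P Q star a b i c w} ≤
      2 * K ^ 2 / (σ ^ 2 * N) := by
  have hNR : (0 : ℝ) < N := by exact_mod_cast hN
  -- Typicality of the whole word, with its multiplicative tolerance, excludes letters of zero mass
  -- everywhere, also beyond the prefix.
  have hP : ∀ k, P.real {c k} ≠ 0 := by
    intro k h0
    have h1 := hcN (c k)
    rw [h0, mul_zero, mul_zero, sub_zero, prefixCount_self] at h1
    have h2 : 0 < (Finset.univ.filter fun k' => c k' = c k).card :=
      Finset.card_pos.2 ⟨k, by simp⟩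
    have h3 : (0 : ℝ) < (Finset.univ.filter fun k' => c k' = c k).card := by exact_mod_cast h2
    exact absurd h1 (not_le.2 (abs_pos.2 h3.ne'))
  set π := Measure.pi fun k => Q (c k)
  have hs : 0 < σ * N := mul_pos hσ hNR
  have hcov : {w | ¬ WindowTest P Q star a b i c w} ⊆
      ({w | ∑ k ∈ prefixIndices N i, outputScore P Q star L (w k) ≤ i * (D - η * K) - σ * N} ∪
        {w | ∑ k ∈ prefixIndices N i, infoDensity P Q (c k) (w k) ≤ i * (I - η * K) - σ * N}) ∪
        {w | ∃ k, (Q (c k)).real {w k} = 0} := by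
    intro w hw
    by_contra hnot
    simp only [Set.mem_union, Set.mem_ofPred_eq, not_or, not_le, not_exists] at hnot
    obtain ⟨⟨h1, h2⟩, h3⟩ := hnot
    refine hw (windowTest_of_score (L := L) hP h3 ?_ ?_)
    · have := mul_le_mul_of_nonneg_right hi hD0
      nlinarith
    · have := mul_le_mul_of_nonneg_right hi hI0
      nlinarith
  have hnull : π.real {w | ∃ k, (Q (c k)).real {w k} = 0} = 0 := by
    rw [measureReal_def, pi_null_of_real_singleton_eq_zero, ENNReal.toReal_zero]
  have h1 := pi_real_score_le Q P hc (fun _ y => outputScore P Q star L y) (fun _ y => hK₁ y) hs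
  have h2 := pi_real_score_le Q P hc (infoDensity P Q) hK₂ hs
  rw [← hD] at h1
  rw [← hI] at h2
  refine (measureReal_mono hcov).trans ((measureReal_union_le _ _).trans ?_)
  rw [hnull, add_zero]
  refine (measureReal_union_le _ _).trans ((add_le_add h1 h2).trans (le_of_eq ?_))
  field_simp
  ring

end WindowTest

/-! ### Exponential bounds against polynomial factors -/

section Asymptotics

lemma tendsto_add_two_pow_mul_exp_neg (d : ℕ) {γ : ℝ} (hγ : 0 < γ) :
    Tendsto (fun N : ℕ => ((N : ℝ) + 2) ^ d * Real.exp (-(γ * N))) atTop (𝓝 0) := by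
  have h1 : |Real.exp (-γ)| < 1 := by
    rw [abs_of_pos (Real.exp_pos _)]
    simpa using hγ
  have h2 := ((tendsto_pow_const_mul_const_pow_of_abs_lt_one d h1).comp
    (tendsto_add_atTop_nat 2)).mul_const (Real.exp (2 * γ))
  rw [zero_mul] at h2
  refine h2.congr fun N => ?_
  simp only [Function.comp_apply]
  push_cast
  rw [mul_assoc, ← Real.exp_nat_mul, ← Real.exp_add]
  congr 2
  push_cast
  ring

lemma tendsto_const_div_natCast (C : ℝ) : Tendsto (fun N : ℕ => C / (N : ℝ)) atTop (𝓝 0) :=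
  tendsto_const_nhds.div_atTop tendsto_natCast_atTop_atTop

lemma natCeil_exp_le_two_mul {x : ℝ} (hx : 0 ≤ x) : (⌈Real.exp x⌉₊ : ℝ) ≤ 2 * Real.exp x := by
  have h1 := (Nat.ceil_lt_add_one (Real.exp_pos x).le).le
  have h2 := Real.one_le_exp hx
  linarith

/-- Windows that meet the transmission contribute the exponent `r - t₂ r`, pure noise windows the
exponent `r + κ - (t₁ + t₂) r`. Since `κ` may be negative, the number of noise windows is bounded by
a polynomial times `1 + exp (κ N)`; the summand 1 is covered by the first exponent. -/
lemma union_bound_le {N d J₁ J₂ : ℕ} {r t₁ t₂ κ γ : ℝ} (hr : 0 ≤ r) (ht₁ : 0 ≤ t₁)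
    (hJ₁ : (J₁ : ℝ) ≤ ((N : ℝ) + 2) ^ d) (hJ₂ : (J₂ : ℝ) ≤ ((N : ℝ) + 2) ^ d)
    (hγ₁ : γ ≤ (t₂ - 1) * r) (hγ₂ : γ ≤ (t₁ + t₂ - 1) * r - κ) :
    (⌈Real.exp (r * N)⌉₊ : ℝ) * (2 * ((⌈Real.exp (κ * N)⌉₊ + N + 1) *
        (2 * (J₂ * Real.exp (-(t₂ * r * N))) * (J₁ * Real.exp (-(t₁ * r * N)))) +
          2 * N * (2 * (J₂ * Real.exp (-(t₂ * r * N)))))) ≤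
      32 * (((N : ℝ) + 2) ^ (2 * d + 1) * Real.exp (-(γ * N))) := by
  set u : ℝ := (N : ℝ) + 2 with hu
  set U := u ^ d with hU
  have hN0 : (0 : ℝ) ≤ N := Nat.cast_nonneg N
  have hu1 : 1 ≤ u := by linarith
  have hU1 : 1 ≤ U := one_le_pow₀ hu1
  set m := Real.exp (r * N) with hm
  set z := Real.exp (κ * N) with hz
  set e₁ := Real.exp (-(t₁ * r * N)) with he₁
  set e₂ := Real.exp (-(t₂ * r * N)) with he₂
  set g := Real.exp (-(γ * N)) with hg
  have hm0 : 0 < m := Real.exp_pos _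
  have hz0 : 0 < z := Real.exp_pos _
  have he₁0 : 0 < e₁ := Real.exp_pos _
  have he₂0 : 0 < e₂ := Real.exp_pos _
  have hg0 : 0 < g := Real.exp_pos _
  have he₁1 : e₁ ≤ 1 := Real.exp_le_one_iff.2 (by
    have := mul_nonneg (mul_nonneg ht₁ hr) hN0; linarith)
  have hM : (⌈m⌉₊ : ℝ) ≤ 2 * m := natCeil_exp_le_two_mul (mul_nonneg hr hN0)
  have hA : (⌈z⌉₊ : ℝ) + N + 1 ≤ u * (1 + z) := by
    have h1 := (Nat.ceil_lt_add_one hz0.le).le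
    nlinarith
  have hme₂ : m * e₂ ≤ g := by
    rw [hm, he₂, hg, ← Real.exp_add]
    refine Real.exp_le_exp.2 ?_
    nlinarith [mul_le_mul_of_nonneg_right hγ₁ hN0]
  have hmze : m * z * e₂ * e₁ ≤ g := by
    rw [hm, he₂, he₁, hz, hg, ← Real.exp_add, ← Real.exp_add, ← Real.exp_add]
    refine Real.exp_le_exp.2 ?_
    nlinarith [mul_le_mul_of_nonneg_right hγ₂ hN0]
  have hJe₂ : J₂ * e₂ ≤ U * e₂ := mul_le_mul_of_nonneg_right hJ₂ he₂0.le
  have hJe₁ : J₁ * e₁ ≤ U * e₁ := mul_le_mul_of_nonneg_right hJ₁ he₁0.le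
  have hstep : (⌈m⌉₊ : ℝ) * (2 * ((⌈z⌉₊ + N + 1) * (2 * (J₂ * e₂) * (J₁ * e₁)) +
      2 * N * (2 * (J₂ * e₂)))) ≤
      (2 * m) * (2 * ((u * (1 + z)) * (2 * (U * e₂) * (U * e₁)) + 2 * u * (2 * (U * e₂)))) := by
    have hNu : (N : ℝ) ≤ u := by linarith
    gcongr
  refine hstep.trans ?_
  have hpow : u ^ (2 * d + 1) = u * U * U := by rw [hU]; ring
  rw [hpow]
  have hUU : U ≤ U * U := le_mul_of_one_le_right (by linarith) hU1
  have huU : 0 ≤ u * U * U := by positivity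
  have h1 : m * e₂ * e₁ ≤ g := by
    calc m * e₂ * e₁ ≤ m * e₂ * 1 := by gcongr
      _ ≤ g := by rw [mul_one]; exact hme₂
  calc (2 * m) * (2 * ((u * (1 + z)) * (2 * (U * e₂) * (U * e₁)) + 2 * u * (2 * (U * e₂))))
      = 8 * (u * U * U) * (m * e₂ * e₁ + m * z * e₂ * e₁) + 16 * (u * U) * (m * e₂) := by ring
    _ ≤ 8 * (u * U * U) * (g + g) + 16 * (u * U * U) * g := by
        gcongr ?_ * (?_ + ?_) + 16 * ?_ * ?_
        rw [mul_assoc u U U]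
        exact mul_le_mul_of_nonneg_left hUU (by linarith)
    _ = 32 * (u * U * U * g) := by ring

lemma card_option_le {ι : Type*} [Fintype ι] {N d : ℕ} (h : Fintype.card ι ≤ (N + 1) ^ d) {e : ℕ}
    (hde : d + 1 ≤ e) : (Fintype.card (Option ι) : ℝ) ≤ ((N : ℝ) + 2) ^ e := by
  have h1 : Fintype.card (Option ι) ≤ (N + 2) ^ e := by
    rw [Fintype.card_option]
    have h2 : (N + 1) ^ d ≤ (N + 2) ^ d := Nat.pow_le_pow_left (by omega) d
    have h3 : 1 ≤ (N + 2) ^ d := Nat.one_le_pow _ _ (by omega)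
    calc Fintype.card ι + 1 ≤ (N + 2) ^ d * 2 := by omega
      _ ≤ (N + 2) ^ d * (N + 2) := Nat.mul_le_mul_left _ (by omega)
      _ = (N + 2) ^ (d + 1) := (pow_succ _ _).symm
      _ ≤ (N + 2) ^ e := Nat.pow_le_pow_right (by omega) hde
  exact_mod_cast h1

end Asymptotics

/-! ### Choice of the score, the window length and the tolerance -/

section Parameters

variable {X Y : Type*} [Fintype X] [MeasurableSpace X] [MeasurableSingletonClass X]
  [Fintype Y] [MeasurableSpace Y] [MeasurableSingletonClass Y]

lemma sum_outputScore (P : Measure X) [IsProbabilityMeasure P] (Q : Kernel X Y)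
    [IsMarkovKernel Q] (f : Y → ℝ) :
    ∑ x, P.real {x} * ∑ y, (Q x).real {y} * f y = ∑ y, (P ⊗ₘ Q).snd.real {y} * f y := by
  simp only [compProd_snd_real_singleton, Finset.mul_sum, Finset.sum_mul]
  rw [Finset.sum_comm]
  simp only [mul_assoc]

/-- The divergence of the output law from noise is approached by means of bounded scores. -/
lemma exists_outputScore_gt (P : Measure X) [IsProbabilityMeasure P] (Q : Kernel X Y)
    [IsMarkovKernel Q] (star : X) {T : ℝ}
    (h : ENNReal.ofReal T < klDiv (P ⊗ₘ Q).snd (Q star)) :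
    ∃ L, T < ∑ x, P.real {x} * ∑ y, (Q x).real {y} * outputScore P Q star L y := by
  classical
  simp only [sum_outputScore]
  by_cases hac : ∀ y, (Q star).real {y} = 0 → (P ⊗ₘ Q).snd.real {y} = 0
  · refine ⟨0, ?_⟩
    rw [klDiv_eq_ofReal_sum hac, ENNReal.ofReal_lt_ofReal_iff'] at h
    refine h.1.trans_le (Finset.sum_le_sum fun y _ => ?_)
    rw [outputScore]
    split_ifs with h0
    · rw [hac y h0, zero_mul, zero_mul]
    · exact le_rfl
  · push Not at hac
    obtain ⟨y₀, hy₀, hp₀⟩ := hac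
    set p : Y → ℝ := fun y => (P ⊗ₘ Q).snd.real {y}
    set v := ∑ y, if (Q star).real {y} = 0 then p y else 0
    set S := ∑ y, if (Q star).real {y} = 0 then 0 else p y * Real.log (p y / (Q star).real {y})
    have hv : 0 < v := by
      refine lt_of_lt_of_le (measureReal_nonneg.lt_of_ne' hp₀ : 0 < p y₀) ?_
      have := Finset.single_le_sum (f := fun y => if (Q star).real {y} = 0 then p y else 0)
        (fun y _ => by
          split_ifs
          · exact measureReal_nonneg
          · exact le_rfl) (Finset.mem_univ y₀)
      simp only [hy₀, if_true] at this
      exact this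
    -- The divergence is infinite here: the letters unseen under noise have mass `v > 0`, and this
    -- `L` makes the mean score equal to `T + 1`.
    refine ⟨(T + 1 - S) / v, ?_⟩
    have : ∑ y, p y * outputScore P Q star ((T + 1 - S) / v) y = (T + 1 - S) / v * v + S := by
      simp only [v, S]
      rw [Finset.mul_sum, ← Finset.sum_add_distrib]
      refine Finset.sum_congr rfl fun y _ => ?_
      rw [outputScore]
      split_ifs
      · ring
      · simp [p]
    rw [this, div_mul_cancel₀ _ hv.ne']
    linarith

/-- At `β₀ = t₂ r / I` the information constraint and `I / t₂ * β₀ = r` are equalities, while the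
divergence constraint is strict by `hD`. A `β` slightly to the right of `β₀` makes the first strict
and, thanks to `ε`, loses little rate. -/
lemma exists_duration {r I D t₁ t₂ ε : ℝ} (hr : 0 < r) (ht₂ : 0 < t₂) (hI : t₂ * r < I)
    (hD : t₁ / t₂ * I < D) (hε : 0 < ε) :
    ∃ β, 0 < β ∧ β < 1 ∧ t₂ * r < β * I ∧ t₁ * r < β * D ∧ (I / t₂ - ε) * β < r := by
  have hI0 : 0 < I := (mul_pos ht₂ hr).trans hI
  set β₀ := t₂ * r / I with hβ₀
  have hβ₀pos : 0 < β₀ := by positivity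
  have hβ₀1 : β₀ < 1 := (div_lt_one hI0).2 hI
  have h2 : t₁ * r < β₀ * D := by
    have h3 := mul_lt_mul_of_pos_left hD hβ₀pos
    have h4 : β₀ * (t₁ / t₂ * I) = t₁ * r := by rw [hβ₀]; field_simp
    linarith
  have h5 : (I / t₂ - ε) * β₀ < r := by
    have h6 : I / t₂ * β₀ = r := by rw [hβ₀]; field_simp
    nlinarith
  have e1 : ∀ᶠ β in 𝓝[>] β₀, β < 1 := nhdsWithin_le_nhds (eventually_lt_nhds hβ₀1)
  have e2 : ∀ᶠ β in 𝓝[>] β₀, t₁ * r < β * D := nhdsWithin_le_nhds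
    ((continuous_id.mul continuous_const).tendsto β₀ |>.eventually (eventually_gt_nhds h2))
  have e3 : ∀ᶠ β in 𝓝[>] β₀, (I / t₂ - ε) * β < r := nhdsWithin_le_nhds
    ((continuous_const.mul continuous_id).tendsto β₀ |>.eventually (eventually_lt_nhds h5))
  obtain ⟨β, h1, h2, h3, h4⟩ := (e1.and (e2.and (e3.and self_mem_nhdsWithin))).exists
  have h4' : β₀ < β := h4
  refine ⟨β, hβ₀pos.trans h4', h1, ?_, h2, h3⟩
  rwa [hβ₀, div_lt_iff₀ hI0] at h4'

/-- All the conditions are strict at `η = 0` and continuous there, so they survive for small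
positive `η`. The alternative `a = 0` stands apart because then there is no gap between `a` and `δ⁻¹
* a`. -/
lemma exists_tolerance {I D K β α ε a a₀ b b₀ c : ℝ} (hb : b < β * I) (ha : a < β * D)
    (hε : 0 < ε) (ha₀ : a = 0 ∨ a < a₀) (hb₀ : b < b₀) :
    ∃ η, 0 < η ∧ η < 1 ∧ b < β * (I - η * K) ∧ a < β * (D - η * K) ∧ η * α < ε ∧
      (1 - η)⁻¹ * b ≤ b₀ ∧ (a = 0 ∨ a + (-Real.log (1 - η) + η / (1 - η) * c) < a₀) := by
  have hev : ∀ {f : ℝ → ℝ} {v : ℝ}, ContinuousAt f 0 → f 0 < v → ∀ᶠ η in 𝓝[>] (0 : ℝ), f η < v :=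
    fun hf h => nhdsWithin_le_nhds (hf.tendsto.eventually (eventually_lt_nhds h))
  have e1 := hev (f := fun η => η) (v := 1) (by fun_prop) one_pos
  have e2 := hev (f := fun η => -(β * (I - η * K))) (v := -b) (by fun_prop) (by simpa using hb)
  have e3 := hev (f := fun η => -(β * (D - η * K))) (v := -a) (by fun_prop) (by simpa using ha)
  have e4 := hev (f := fun η => η * α) (v := ε) (by fun_prop) (by simpa using hε)
  have e5 := hev (f := fun η => (1 - η)⁻¹ * b) (v := b₀)
    (by fun_prop (disch := norm_num)) (by simpa using hb₀)
  have e6 : ∀ᶠ η in 𝓝[>] (0 : ℝ),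
      (a = 0 ∨ a + (-Real.log (1 - η) + η / (1 - η) * c) < a₀) := by
    rcases ha₀ with h | h
    · exact Eventually.of_forall fun _ => Or.inl h
    · exact (hev (f := fun η => a + (-Real.log (1 - η) + η / (1 - η) * c)) (v := a₀)
        (by fun_prop (disch := norm_num)) (by simpa using h)).mono fun _ h => Or.inr h
  obtain ⟨η, h1, h2, h3, h4, h5, h6, h7⟩ :=
    (e1.and (e2.and (e3.and (e4.and (e5.and (e6.and self_mem_nhdsWithin)))))).exists
  exact ⟨η, h7, h1, by linarith, by linarith, h4, h5.le, h6⟩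

end Parameters

lemma rate_ge_of_expectedDelay_le {X Y : Type*} [MeasurableSpace X] [MeasurableSpace Y] {M N : ℕ}
    (D : BlockCode X Y M N) (Q : Kernel X Y) (star : X) (A : ℕ) {ρ e : ℝ} (he : 0 ≤ e)
    (hM : 0 < Real.log M) (hD : D.expectedDelay Q star A ≤ ENNReal.ofReal e)
    (h : ρ * e ≤ Real.log M) : ENNReal.ofReal ρ ≤ D.rate Q star A := by
  rw [BlockCode.rate, ENNReal.le_div_iff_mul_le (Or.inr (by simpa using hM))
    (Or.inr ENNReal.ofReal_ne_top)]
  refine (mul_le_mul_right hD _).trans ?_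
  rw [← ENNReal.ofReal_mul' he]
  exact ENNReal.ofReal_le_ofReal h

/-! ### Assembly of the code -/

section Main

variable {X Y : Type*} [Fintype X] [DecidableEq X] [MeasurableSpace X]
  [MeasurableSingletonClass X] [Fintype Y] [DecidableEq Y] [MeasurableSpace Y]
  [MeasurableSingletonClass Y]

/-- Codes with `⌈e ^ (r N)⌉` messages, for the parameters of the decoder that make the error
exponents positive. -/
lemma eventually_exists_code (Q : Kernel X Y) [IsMarkovKernel Q] (star : X) (P : Measure X)
    [IsProbabilityMeasure P] {α t₁ t₂ r a₀ b₀ I D L ε ε' η β : ℝ} (ht₁ : 0 ≤ t₁) (ht₂ : 1 < t₂)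
    (hr : 0 < r) (hα : α ≤ (t₁ + t₂ - 1) * r) (hε : 0 < ε) (hε' : 0 < ε')
    (hη0 : 0 < η) (hη1 : η < 1) (hηα : η * α < ε) (hβ0 : 0 < β) (hβ1 : β < 1)
    (hfull : α = 0 ∨
      ((∀ V : Kernel X Y, IsMarkovKernel V → klDiv (P ⊗ₘ V).snd (Q star) < ENNReal.ofReal a₀ →
        ENNReal.ofReal α < klDiv (P ⊗ₘ V).snd (P ⊗ₘ Q).snd) ∧
      (∀ V : Kernel X Y, IsMarkovKernel V → mutualInfo (P ⊗ₘ V) ≤ ENNReal.ofReal b₀ →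
        ENNReal.ofReal α < klDiv (P ⊗ₘ V) (P ⊗ₘ Q)) ∧
      (t₁ * r = 0 ∨ (t₁ * r + (-Real.log (1 - η) + η / (1 - η) *
        (Fintype.card Y * (1 + ∑ y, |Real.log ((Q star).real {y})|))) < a₀ ∧ 0 < a₀)) ∧
      (1 - η)⁻¹ * (t₂ * r) ≤ b₀))
    {K : ℝ} (hK₁ : ∀ y, |outputScore P Q star L y| ≤ K) (hK₂ : ∀ x y, |infoDensity P Q x y| ≤ K)
    (hD : D = ∑ x, P.real {x} * ∑ y, (Q x).real {y} * outputScore P Q star L y)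
    (hI : I = ∑ x, P.real {x} * ∑ y, (Q x).real {y} * infoDensity P Q x y)
    (hDβ : t₁ * r < β * (D - η * K)) (hIβ : t₂ * r < β * (I - η * K)) :
    ∃ e : ℝ, ∀ᶠ N : ℕ in atTop, ∃ C : BlockCode X Y ⌈Real.exp (r * N)⌉₊ N,
      C.expectedDelay Q star ⌈Real.exp ((α - ε) * N)⌉₊ ≤ ENNReal.ofReal (β * N + e) ∧
      C.errorProb Q star ⌈Real.exp ((α - ε) * N)⌉₊ ≤ ENNReal.ofReal ε' := by
  obtain ⟨σ, hσ0, hσD, hσI⟩ : ∃ σ, 0 < σ ∧ t₁ * r + σ < β * (D - η * K) ∧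
      t₂ * r + σ < β * (I - η * K) := by
    obtain ⟨σ, h0, h1⟩ := exists_between (lt_min (sub_pos.2 hDβ) (sub_pos.2 hIβ))
    have := lt_min_iff.1 h1
    exact ⟨σ, h0, by linarith, by linarith⟩
  have hD0 : 0 ≤ D - η * K := by
    by_contra! h
    nlinarith [mul_nonneg ht₁ hr.le]
  have hI0 : 0 ≤ I - η * K := by
    by_contra! h
    nlinarith [mul_pos (zero_lt_one.trans ht₂) hr]
  set d := Fintype.card X * Fintype.card Y + Fintype.card Y + 1 with hd
  -- A common positive decay exponent for the two kinds of false alarm; the second is positive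
  -- because `α` exceeds `α - ε`.
  obtain ⟨γ, hγ0, hγ⟩ := exists_between (lt_min
    (show 0 < (t₂ - 1) * r from mul_pos (by linarith) hr)
    (show 0 < (t₁ + t₂ - 1) * r - (α - ε) by linarith))
  have hγ₁ := (lt_min_iff.1 hγ).1.le
  have hγ₂ := (lt_min_iff.1 hγ).2.le
  have hpoly := tendsto_add_two_pow_mul_exp_neg (2 * d + 1) hγ0
  have hpoly₂ := tendsto_add_two_pow_mul_exp_neg d (show 0 < ε - η * α by linarith)
  have herr : Tendsto (fun N : ℕ => 2 * K ^ 2 / σ ^ 2 / (N : ℝ) +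
      32 * (((N : ℝ) + 2) ^ (2 * d + 1) * Real.exp (-(γ * N)))) atTop (𝓝 0) := by
    simpa using (tendsto_const_div_natCast (2 * K ^ 2 / σ ^ 2)).add (hpoly.const_mul 32)
  have htyp : Tendsto (fun N : ℕ => (∑ x, 2 / (η * β * P.real {x}) ^ 2 +
      ∑ x, 2 / (η * β * P.real {x}) ^ 2) / (N : ℝ)) atTop (𝓝 0) := tendsto_const_div_natCast _
  refine ⟨1 + 2 * K ^ 2 / σ ^ 2 + 2, ?_⟩
  filter_upwards [eventually_gt_atTop 0, herr.eventually (eventually_le_nhds hε'),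
    htyp.eventually (eventually_le_nhds (show (0 : ℝ) < 1 / 2 by norm_num)),
    hpoly₂.eventually (eventually_le_nhds one_pos)] with N hN hNerr hNtyp hNpoly
  have hNR : (0 : ℝ) < N := by exact_mod_cast hN
  set n₀ := ⌈β * N⌉₊ with hn₀
  have hn₀pos : 1 ≤ n₀ := Nat.ceil_pos.2 (by positivity)
  have hn₀N : n₀ ≤ N := Nat.ceil_le.2 (by nlinarith)
  have hn₀β : β * N ≤ n₀ := Nat.le_ceil _
  have hn₀up : (n₀ : ℝ) ≤ β * N + 1 := (Nat.ceil_lt_add_one (by positivity)).le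
  let G : Set (Fin N → X) :=
    {c | TypeClose P η n₀ (prefixCount c n₀) ∧ TypeClose P η N (prefixCount c N)}
  have hG : 1 / 2 ≤ (Measure.pi fun _ : Fin N => P).real G := by
    have h1 := pi_real_not_typeClose_le (N := N) P hη0 hβ0 hN hn₀β hn₀N
    have h2 := pi_real_not_typeClose_le (N := N) P hη0 hβ0 hN
      (show β * N ≤ (N : ℝ) by nlinarith) le_rfl
    have h3 : Gᶜ = {c | ¬ TypeClose P η n₀ (prefixCount c n₀)} ∪
        {c | ¬ TypeClose P η N (prefixCount c N)} := by
      ext c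
      simp only [G, Set.mem_compl_iff, Set.mem_union, Set.mem_ofPred_eq, not_and_or]
    have h4 : ∑ x, 2 / ((N : ℝ) * (η * β * P.real {x}) ^ 2) =
        (∑ x, 2 / (η * β * P.real {x}) ^ 2) / (N : ℝ) := by
      rw [Finset.sum_div]
      refine Finset.sum_congr rfl fun x _ => ?_
      rw [mul_comm, div_div]
    have h5 : (Measure.pi fun _ : Fin N => P).real Gᶜ ≤ 1 / 2 := by
      rw [h3]
      refine (measureReal_union_le _ _).trans ((add_le_add h1 h2).trans ?_)
      rw [h4, ← add_div]
      exact hNtyp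
    rw [probReal_compl_eq_one_sub (Set.toFinite G).measurableSet] at h5
    linarith
  set J₃ : ℝ := ((Fintype.card (X → Y → Fin (N + 1)) : ℕ) : ℝ) with hJ₃
  -- The cap at 1 handles the rounding in `A ≤ 1 + exp ((α - ε) N)`: the summand 1 then contributes
  -- at most 1 to `A * p₂`.
  set p₂ : ℝ := min 1 (J₃ * Real.exp (-((1 - η) * α * N))) with hp₂
  have hp₂0 : 0 ≤ p₂ := le_min zero_le_one (by positivity)
  have hp₁le : ∀ c ∈ G, (Measure.pi fun k => Q (c k)).real
      {w | ¬ WindowTest P Q star (t₁ * r) (t₂ * r) n₀ c w} ≤ 2 * K ^ 2 / (σ ^ 2 * N) :=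
    fun c hc => pi_real_not_windowTest_le hN hn₀β hc.1 hc.2 hσ0 hK₁ hK₂ hD hI hD0 hI0 hσD hσI
  have hp₂le : ∀ c ∈ G, (Measure.pi fun k => Q (c k)).real
      {w | ¬ WindowTest P Q star (t₁ * r) (t₂ * r) N c w} ≤ p₂ := by
    intro c hc
    refine le_min measureReal_le_one ?_
    -- For `α = 0` the exponential factor is 1, and the bound is trivial because `J₃ ≥ 1`.
    rcases hfull with h0 | ⟨ha, hb, haη, hbη⟩
    · have h1 : (1 : ℝ) ≤ J₃ := by
        rw [hJ₃]
        exact_mod_cast Fintype.card_pos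
      simpa [h0] using measureReal_le_one.trans h1
    · exact pi_real_not_windowTest_self_le hη0.le hη1 ha hb haη hbη hN hc.2
  have hA0 : ⌈Real.exp ((α - ε) * N)⌉₊ ≠ 0 := (Nat.ceil_pos.2 (Real.exp_pos _)).ne'
  have hM0 : ⌈Real.exp (r * N)⌉₊ ≠ 0 := (Nat.ceil_pos.2 (Real.exp_pos _)).ne'
  obtain ⟨C, hCerr, hCdelay⟩ := exists_code Q star P
    (outputFamily_nonneg P Q) (sum_outputFamily_le_one P Q) (inputFamily_nonneg P Q)
    (sum_inputFamily_le_one P Q) (Real.exp_pos _).le (Real.exp_pos _).le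
    (fun i c w => (Iff.rfl : WindowTest P Q star (t₁ * r) (t₂ * r) i c w ↔ _))
    hn₀pos hn₀N hA0 hM0 G hG (by positivity) hp₂0 hp₁le hp₂le
  refine ⟨C, hCdelay.trans (ENNReal.ofReal_le_ofReal ?_),
    hCerr.trans (ENNReal.ofReal_le_ofReal ?_)⟩
  · have h1 : N * (2 * K ^ 2 / (σ ^ 2 * N)) = 2 * K ^ 2 / σ ^ 2 := by field_simp
    have h2 : (⌈Real.exp ((α - ε) * N)⌉₊ : ℝ) * p₂ ≤ 2 := by
      have h3 : (⌈Real.exp ((α - ε) * N)⌉₊ : ℝ) ≤ 1 + Real.exp ((α - ε) * N) := by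
        have := (Nat.ceil_lt_add_one (Real.exp_pos ((α - ε) * N)).le).le
        linarith
      have h4 : J₃ ≤ ((N : ℝ) + 2) ^ d := by
        rw [hJ₃, Fintype.card_fun, Fintype.card_fun, Fintype.card_fin, ← pow_mul]
        push_cast
        calc ((N : ℝ) + 1) ^ (Fintype.card Y * Fintype.card X)
            ≤ ((N : ℝ) + 2) ^ (Fintype.card Y * Fintype.card X) := by gcongr; norm_num
          _ ≤ ((N : ℝ) + 2) ^ d := pow_le_pow_right₀ (by linarith) (by
              rw [hd, mul_comm]; omega)
      have h5 : Real.exp ((α - ε) * N) * p₂ ≤ 1 := by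
        calc Real.exp ((α - ε) * N) * p₂
            ≤ Real.exp ((α - ε) * N) * (J₃ * Real.exp (-((1 - η) * α * N))) := by
              gcongr
              exact min_le_right _ _
          _ = J₃ * Real.exp (-((ε - η * α) * N)) := by
              rw [mul_left_comm, ← Real.exp_add]
              congr 2
              ring
          _ ≤ ((N : ℝ) + 2) ^ d * Real.exp (-((ε - η * α) * N)) := by gcongr
          _ ≤ 1 := hNpoly
      calc (⌈Real.exp ((α - ε) * N)⌉₊ : ℝ) * p₂ ≤ (1 + Real.exp ((α - ε) * N)) * p₂ := by gcongr
        _ = p₂ + Real.exp ((α - ε) * N) * p₂ := by ring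
        _ ≤ 1 + 1 := add_le_add (min_le_left _ _) h5
        _ = 2 := by norm_num
    rw [h1]
    linarith
  · refine le_trans (add_le_add ?_ (union_bound_le (d := d) hr.le ht₁ ?_ ?_ hγ₁ hγ₂)) hNerr
    · exact le_of_eq (by rw [div_div])
    · refine card_option_le (d := Fintype.card Y) ?_ (by omega)
      rw [Fintype.card_fun, Fintype.card_fin]
    · refine card_option_le (d := Fintype.card X * Fintype.card Y) ?_ (by omega)
      rw [Fintype.card_fun, Fintype.card_fun, Fintype.card_fin, ← pow_mul]

end Main

end AsyncComm

/-! ### Parameters satisfying the hypotheses, and the resulting rate -/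

open AsyncComm in
theorem theorem2 {X Y : Type*}
    [Finite X] [MeasurableSpace X] [MeasurableSingletonClass X]
    [Finite Y] [MeasurableSpace Y] [MeasurableSingletonClass Y]
    (Q : Kernel X Y) [IsMarkovKernel Q] (star : X)
    (P : Measure X) [IsProbabilityMeasure P]
    (α t₁ t₂ δ : ℝ) (hα : 0 ≤ α) (ht₁ : 0 ≤ t₁) (ht₂ : 1 < t₂) (hδ₀ : 0 < δ) (hδ₁ : δ < 1)
    (hI : 0 < AsyncComm.mutualInfo (P ⊗ₘ Q))
    (ha : ENNReal.ofReal α <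
      ⨅ (V : Kernel X Y) (_ : IsMarkovKernel V)
        (_ : klDiv (P ⊗ₘ V).snd (Q star) < ENNReal.ofReal (t₁ * α / (δ * (t₁ + t₂ - 1)))),
        klDiv (P ⊗ₘ V).snd (P ⊗ₘ Q).snd)
    (hb : ENNReal.ofReal α <
      ⨅ (V : Kernel X Y) (_ : IsMarkovKernel V)
        (_ : AsyncComm.mutualInfo (P ⊗ₘ V) ≤ ENNReal.ofReal (t₂ * α / (δ * (t₁ + t₂ - 1)))),
        klDiv (P ⊗ₘ V) (P ⊗ₘ Q))
    (hc : ENNReal.ofReal (t₁ / t₂) <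
      klDiv (P ⊗ₘ Q).snd (Q star) / AsyncComm.mutualInfo (P ⊗ₘ Q)) :
    AsyncComm.Achievable Q star α ((AsyncComm.mutualInfo (P ⊗ₘ Q)).toReal / t₂) := by
  classical
  have := Fintype.ofFinite X
  have := Fintype.ofFinite Y
  intro ε hε
  have ht₂0 : 0 < t₂ := zero_lt_one.trans ht₂
  set I := (mutualInfo (P ⊗ₘ Q)).toReal with hIdef
  have hIsum := mutualInfo_compProd_eq P Q
  have hItop : mutualInfo (P ⊗ₘ Q) ≠ ⊤ := by rw [hIsum]; exact ENNReal.ofReal_ne_top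
  have hI0 : 0 < I := ENNReal.toReal_pos hI.ne' hItop
  have hIof : mutualInfo (P ⊗ₘ Q) = ENNReal.ofReal I := (ENNReal.ofReal_toReal hItop).symm
  have hIdens : I = ∑ x, P.real {x} * ∑ y, (Q x).real {y} * infoDensity P Q x y := by
    have h1 : 0 < ENNReal.ofReal (∑ x, P.real {x} *
      ∑ y, (Q x).real {y} * Real.log ((Q x).real {y} / (P ⊗ₘ Q).snd.real {y})) := hIsum ▸ hI
    rw [hIdef, hIsum, ENNReal.toReal_ofReal (ENNReal.ofReal_pos.1 h1).le]
    rfl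
  have ha' : ∀ V : Kernel X Y, IsMarkovKernel V →
      klDiv (P ⊗ₘ V).snd (Q star) < ENNReal.ofReal (t₁ * α / (δ * (t₁ + t₂ - 1))) →
      ENNReal.ofReal α < klDiv (P ⊗ₘ V).snd (P ⊗ₘ Q).snd := fun V h1 h2 =>
    ha.trans_le ((iInf_le _ V).trans ((iInf_le _ h1).trans (iInf_le _ h2)))
  have hb' : ∀ V : Kernel X Y, IsMarkovKernel V →
      mutualInfo (P ⊗ₘ V) ≤ ENNReal.ofReal (t₂ * α / (δ * (t₁ + t₂ - 1))) →
      ENNReal.ofReal α < klDiv (P ⊗ₘ V) (P ⊗ₘ Q) := fun V h1 h2 =>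
    hb.trans_le ((iInf_le _ V).trans ((iInf_le _ h1).trans (iInf_le _ h2)))
  have ht : 0 < t₁ + t₂ - 1 := by linarith
  -- the exponent of the number of messages
  obtain ⟨r, hr, hrI, hrα, hrcase⟩ : ∃ r, 0 < r ∧ t₂ * r < I ∧ α ≤ (t₁ + t₂ - 1) * r ∧
      (α = 0 ∨ r = α / (t₁ + t₂ - 1)) := by
    rcases hα.eq_or_lt with h0 | h0
    -- For `α = 0` any positive `r` with `t₂ * r < I` would do; this one takes half of the range.
    · refine ⟨I / (2 * t₂), by positivity, ?_, ?_, Or.inl h0.symm⟩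
      · have : t₂ * (I / (2 * t₂)) = I / 2 := by field_simp
        linarith
      · rw [← h0]; positivity
    · refine ⟨α / (t₁ + t₂ - 1), by positivity, ?_, ?_, Or.inr rfl⟩
      -- Otherwise `V = Q` would be admissible in (b), with divergence zero.
      · have h1 : t₂ * α / (δ * (t₁ + t₂ - 1)) < I := by
          by_contra! h
          have := hb' Q inferInstance (by rw [hIof]; exact ENNReal.ofReal_le_ofReal h)
          rw [klDiv_self] at this
          exact not_lt_zero this
        refine lt_of_le_of_lt ?_ h1
        rw [mul_div_assoc']
        refine div_le_div_of_nonneg_left (by positivity) (by positivity) ?_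
        nlinarith
      · rw [mul_div_cancel₀ _ ht.ne']
  obtain ⟨L, hL⟩ := exists_outputScore_gt (T := t₁ / t₂ * I) P Q star (by
    rw [hIof, ENNReal.lt_div_iff_mul_lt (Or.inl (by simpa using hI0))
      (Or.inl ENNReal.ofReal_ne_top), ← ENNReal.ofReal_mul (by positivity)] at hc
    exact hc)
  obtain ⟨D, hD⟩ : ∃ D, D = ∑ x, P.real {x} * ∑ y, (Q x).real {y} * outputScore P Q star L y :=
    ⟨_, rfl⟩
  rw [← hD] at hL
  obtain ⟨β, hβ0, hβ1, hβI, hβD, hβr⟩ := exists_duration hr ht₂0 hrI hL hε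
  obtain ⟨K, hK₁, hK₂⟩ : ∃ K, (∀ y, |outputScore P Q star L y| ≤ K) ∧
      ∀ x y, |infoDensity P Q x y| ≤ K := by
    refine ⟨∑ y, |outputScore P Q star L y| + ∑ x, ∑ y, |infoDensity P Q x y|,
      fun y => ?_, fun x y => ?_⟩
    · exact (Finset.single_le_sum (f := fun y => |outputScore P Q star L y|)
        (fun _ _ => abs_nonneg _) (Finset.mem_univ y)).trans
        (le_add_of_nonneg_right (Finset.sum_nonneg fun _ _ => Finset.sum_nonneg fun _ _ =>
          abs_nonneg _))
    · refine le_trans ?_ (le_add_of_nonneg_left (Finset.sum_nonneg fun _ _ => abs_nonneg _))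
      exact (Finset.single_le_sum (f := fun y => |infoDensity P Q x y|)
        (fun _ _ => abs_nonneg _) (Finset.mem_univ y)).trans
        (Finset.single_le_sum (f := fun x => ∑ y, |infoDensity P Q x y|)
          (fun _ _ => Finset.sum_nonneg fun _ _ => abs_nonneg _) (Finset.mem_univ x))
  -- For `α > 0` the thresholds of (a) and (b) are `δ⁻¹` times the test exponents `t₁ r` and `t₂ r`;
  -- this gap pays for the tolerance `η`.
  have hδinv : 1 < δ⁻¹ := (one_lt_inv₀ hδ₀).2 hδ₁
  have hslack : ∀ v, 0 < v → v < δ⁻¹ * v := fun v hv => by nlinarith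
  obtain ⟨η, hη0, hη1, hηI, hηD, hηα, hηb, hηa⟩ := exists_tolerance (K := K) (α := α)
    (a₀ := δ⁻¹ * (t₁ * r)) (b₀ := δ⁻¹ * (t₂ * r))
    (c := Fintype.card Y * (1 + ∑ y, |Real.log ((Q star).real {y})|)) hβI hβD hε
    (by
      rcases (mul_nonneg ht₁ hr.le).eq_or_lt with h | h
      · exact Or.inl h.symm
      · exact Or.inr (hslack _ h))
    (hslack _ (by positivity))
  obtain ⟨e, he⟩ := eventually_exists_code Q star P ht₁ ht₂ hr hrα hε hε hη0 hη1 hηα hβ0 hβ1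
    (a₀ := t₁ * α / (δ * (t₁ + t₂ - 1))) (b₀ := t₂ * α / (δ * (t₁ + t₂ - 1)))
    (by
      rcases hrcase with h0 | h0
      · exact Or.inl h0
      have heq : ∀ s : ℝ, s * α / (δ * (t₁ + t₂ - 1)) = δ⁻¹ * (s * r) := fun s => by
        rw [h0]; field_simp
      refine Or.inr ⟨ha', hb', ?_, by rw [heq]; exact hηb⟩
      rcases (mul_nonneg ht₁ hr.le).eq_or_lt with h | h
      · exact Or.inl h.symm
      · refine Or.inr ⟨by rw [heq]; exact hηa.resolve_left h.ne', by rw [heq]; positivity⟩)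
    hK₁ hK₂ hD hIdens hηD hηI
  -- Since `(I / t₂ - ε) * β < r` strictly, the bounded excess delay `e` does not affect the rate
  -- for large `N`.
  have hlin : Tendsto (fun N : ℕ => (r - (I / t₂ - ε) * β) * (N : ℝ)) atTop atTop :=
    tendsto_natCast_atTop_atTop.const_mul_atTop (by linarith)
  have hlin₂ : Tendsto (fun N : ℕ => β * (N : ℝ)) atTop atTop :=
    tendsto_natCast_atTop_atTop.const_mul_atTop hβ0
  filter_upwards [he, eventually_gt_atTop 0, hlin.eventually_ge_atTop ((I / t₂ - ε) * e),
    hlin₂.eventually_ge_atTop (-e)] with N ⟨C, hCdelay, hCerr⟩ hN hNrate hNe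
  have hNR : (0 : ℝ) < N := by exact_mod_cast hN
  have hexp : 1 < Real.exp (r * N) := Real.one_lt_exp_iff.2 (by positivity)
  have hlog : r * N ≤ Real.log ⌈Real.exp (r * N)⌉₊ := by
    rw [Real.le_log_iff_exp_le (by exact_mod_cast Nat.ceil_pos.2 (Real.exp_pos _))]
    exact Nat.le_ceil _
  refine ⟨⌈Real.exp (r * N)⌉₊, Nat.lt_ceil.2 (by simpa using hexp), C, ?_, hCerr⟩
  refine rate_ge_of_expectedDelay_le C Q star _ (e := β * N + e) (by linarith)
    (lt_of_lt_of_le (by positivity) hlog) hCdelay (le_trans ?_ hlog)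
  nlinarith
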